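/- Let $d\ge 2$ and $0\le j\le d-2$ be fixed integers. The random $d$-process on $n$ labelled vertices starts with the empty graph and, in each step, adds one edge chosen uniformly at random from all pairs of distinct vertices that are not yet edges and both of whose vertices have current degree less than $d$; it stops when there is no such pair. Put $N=\lfloor dn/2\rfloor$, let $D_j(s)$ be the number of vertices of degree $j$ in the graph of the process with $s$ edges, and let $D^*_j(t)=D_j(N-t)$ be that number at deficit $t$. Let $\gamma$ be a constant with $0<\gamma<d-1-j$ and let $t=t(n)$ be nonnegative integers with $t(n)\sim\log^{\gamma}n$ as $n\to\infty$. (Then $t\le N$ and the process reaches deficit $t$ for all large $n$.) Then, as $n\to\infty$, $$\mathbb P\bigl(D^*_j(t)=1\bigr)\sim\frac{2\,[d-1]_{d-1-j}}{\log^{\,d-1-j-\gamma}n},$$ where $[x]_k=x(x-1)\cdots(x-k+1)$ and $\log$ is the natural logarithm. -/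

import Mathlib

noncomputable section

namespace RandomDGraph

open Classical in
/-- The pairs of distinct vertices which are not yet edges of `G` and both of whose vertices
have degree less than `d` in `G`. -/
def available {V : Type*} [Fintype V] (d : ℕ) (G : SimpleGraph V) : Finset (Sym2 V) :=
  Finset.univ.filter fun e => ¬ e.IsDiag ∧ e ∉ G.edgeSet ∧ ∀ v ∈ e, G.degree v < d

/-- One step of the `d`-process: add an edge chosen uniformly at random from the available pairs.
If there is none, the process has terminated and the graph no longer changes. -/
def step {V : Type*} [Fintype V] (d : ℕ) (G : SimpleGraph V) : PMF (SimpleGraph V) :=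
  open Classical in
  if h : (available d G).Nonempty then
    (PMF.uniformOfFinset (available d G) h).map fun e => G ⊔ SimpleGraph.fromEdgeSet {e}
  else PMF.pure G

/-- The law of the graph `G_s` obtained after `s` steps of the `d`-process on `n` vertices, which
starts with the empty graph. -/
def graphLaw (d n : ℕ) : ℕ → PMF (SimpleGraph (Fin n))
  | 0 => PMF.pure ⊥
  | s + 1 => (graphLaw d n s).bind (step d)

open Classical in
/-- The number of vertices of degree `j` in `G`. -/
def degreeCount {V : Type*} [Fintype V] (j : ℕ) (G : SimpleGraph V) : ℕ :=
  (Finset.univ.filter fun v => G.degree v = j).card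

/-- The maximum possible number of edges, `N = ⌊d n / 2⌋`. -/
def maxEdges (d n : ℕ) : ℕ := d * n / 2

/-- The law of the number of vertices of degree `j` at deficit `t`, that is, when `N - t` edges
have been added (meaningful for `t ≤ N`). -/
def degreeCountLaw (d n j t : ℕ) : PMF ℕ :=
  (graphLaw d n (maxEdges d n - t)).map (degreeCount j)

end RandomDGraph

end

/-! ### Available pairs, hitting probabilities and one-step expectations. -/

noncomputable section

namespace RandomDGraph

open Finset

section Combinatorics

variable {V : Type*} [Fintype V]

/-! Let `U` be the number of unsaturated vertices and `ρ` the total of the missing degrees, which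
falls by 2 in each step. An unsaturated vertex is hit by the next edge with probability close to `2
/ U` (`hitProb_bounds`). The argument has two phases.

From the start until `ρ` is a power of `log n`, the process carries a clock `X` advancing by `2 / U`
per step, so that in clock time each unsaturated vertex gains degree at rate about one. If vertices
were independent Poisson counters, the number of degree `i` would be `n e^{-X} X^i / i!`. The
functions `charlier k` solve the backward equations of such counters, hence their sums over all
vertices are nearly martingales. A second moment recursion (`clockStep_deviation_le`,
`expAt_deviation_le`) keeps the squared deviations far below `n ^ 2`, and inverting the triangular
system (`sum_charlier`) gives the Poisson profile. Then `X ~ log n`, degree `d - 1` dominates `ρ`,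
and dividing eliminates the random factor `n e^{-X}`: the count of degree `i` over `ρ`, times `log n
^ (d - 1 - i)`, tends to `(d - 1)! / i!` (`tendsto_degCount_ratio`), also in expectation
(`tendsto_expAt_burnIn`).

From there to deficit `t` almost every unsaturated vertex misses a single degree, so a given vertex
is hit with probability about `2 / ρ` and the expected number of vertices of degree `j` shrinks in
proportion to `ρ`. Inflow from lower degrees is harmless for the upper bound if a vertex of degree
`i ≤ j` gets weight `θ ^ (j - i)` with `θ = √(log n)`: moving up costs a factor `θ`, yet the lower
degrees, rarer by powers of `log n`, still contribute negligibly (`expAt_weight_le`,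
`tendsto_weight_ratio`). For the lower bound inflow is discarded, and the excess of `2 / U` over `2
/ ρ` is paid for by pairs of low-degree vertices (`expAt_pairWeight_le`, `expAt_degCount_ge`).

Finally, with `D` the number of vertices of degree `j`, `D - D (D - 1) ≤ 1_{D = 1} ≤ D`. Since `t`
is of smaller order than `log n ^ (d - 1 - j)`, the expectation of `D (D - 1)` is negligible against
that of `D`, and `ρ ~ 2 t` yields the factor 2. -/

open Classical in
/-- The degree of `v` in `G`. -/
def deg (G : SimpleGraph V) (v : V) : ℕ := G.degree v

open Classical in
/-- The vertices of degree less than `d`. -/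
def unsat (d : ℕ) (G : SimpleGraph V) : Finset V := univ.filter fun v => deg G v < d

/-- `G` together with the edge `e`. -/
def addEdge (G : SimpleGraph V) (e : Sym2 V) : SimpleGraph V := G ⊔ SimpleGraph.fromEdgeSet {e}

open Classical in
/-- The available pairs which contain `v`. -/
def availableAt (d : ℕ) (G : SimpleGraph V) (v : V) : Finset (Sym2 V) :=
  (available d G).filter fun e => v ∈ e

theorem mem_available {d : ℕ} {G : SimpleGraph V} {e : Sym2 V} :
    e ∈ available d G ↔ ¬ e.IsDiag ∧ e ∉ G.edgeSet ∧ ∀ v ∈ e, deg G v < d := by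
  simp [available, deg]

theorem mem_unsat {d : ℕ} {G : SimpleGraph V} {v : V} : v ∈ unsat d G ↔ deg G v < d := by
  simp [unsat]

theorem deg_bot (v : V) : deg (⊥ : SimpleGraph V) v = 0 := by
  classical
  simp [deg]

open Classical in
theorem deg_addEdge {d : ℕ} {G : SimpleGraph V} {e : Sym2 V} (he : e ∈ available d G) (v : V) :
    deg (addEdge G e) v = deg G v + if v ∈ e then 1 else 0 := by
  obtain ⟨hd, hG, -⟩ := mem_available.1 he
  induction e with | _ a b =>
  have hab : a ≠ b := by simpa using hd
  have hG' : ¬ G.Adj a b := by simpa using hG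
  unfold deg
  simp only [← SimpleGraph.card_neighborFinset_eq_degree]
  have key : ∀ w, (addEdge G s(a, b)).Adj v w ↔ G.Adj v w ∨ (v = a ∧ w = b) ∨ (v = b ∧ w = a) := by
    intro w
    simp only [addEdge, SimpleGraph.sup_adj, SimpleGraph.fromEdgeSet_adj, Set.mem_singleton_iff,
      Sym2.eq_iff]
    constructor
    · rintro (h | ⟨h, -⟩) <;> tauto
    · rintro (h | ⟨rfl, rfl⟩ | ⟨rfl, rfl⟩)
      · exact Or.inl h
      · exact Or.inr ⟨Or.inl ⟨rfl, rfl⟩, hab⟩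
      · exact Or.inr ⟨Or.inr ⟨rfl, rfl⟩, hab.symm⟩
  by_cases hva : v = a
  · subst hva
    rw [if_pos (by simp)]
    have : (addEdge G s(v, b)).neighborFinset v = insert b (G.neighborFinset v) := by
      ext w
      simp only [SimpleGraph.mem_neighborFinset, key, mem_insert]
      constructor
      · rintro (h | ⟨-, h⟩ | ⟨h, -⟩)
        · exact Or.inr h
        · exact Or.inl h
        · exact absurd h hab
      · rintro (h | h) <;> tauto
    rw [this, card_insert_of_notMem (by simpa using hG')]
  by_cases hvb : v = b
  · subst hvb
    rw [if_pos (by simp)]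
    have : (addEdge G s(a, v)).neighborFinset v = insert a (G.neighborFinset v) := by
      ext w
      simp only [SimpleGraph.mem_neighborFinset, key, mem_insert]
      constructor
      · rintro (h | ⟨h, -⟩ | ⟨-, h⟩)
        · exact Or.inr h
        · exact absurd h.symm hab
        · exact Or.inl h
      · rintro (h | h) <;> tauto
    rw [this, card_insert_of_notMem (by simpa [SimpleGraph.adj_comm] using hG')]
  · rw [if_neg (by simp [hva, hvb])]
    congr 1
    ext w
    simp [key, hva, hvb]

open Classical in
theorem sum_mem_eq_two {e : Sym2 V} (he : ¬ e.IsDiag) :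
    ∑ v : V, (if v ∈ e then (1 : ℕ) else 0) = 2 := by
  induction e with | _ a b =>
  have hab : a ≠ b := by simpa using he
  rw [← card_filter]
  have : (univ.filter fun v => v ∈ s(a, b)) = {a, b} := by ext; simp
  rw [this, card_pair hab]

theorem availableAt_eq_empty {d : ℕ} {G : SimpleGraph V} {v : V} (hv : v ∉ unsat d G) :
    availableAt d G v = ∅ := by
  classical
  refine filter_eq_empty_iff.2 fun e he hve => hv (mem_unsat.2 ((mem_available.1 he).2.2 v hve))

/-- The partners of `v` are the other unsaturated vertices except its neighbours, of which there are
fewer than `d`. -/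
theorem card_availableAt {d : ℕ} {G : SimpleGraph V} {v : V} (hv : v ∈ unsat d G) :
    #(availableAt d G v) + 1 ≤ #(unsat d G) ∧ #(unsat d G) ≤ #(availableAt d G v) + d := by
  classical
  have h : availableAt d G v =
      (((unsat d G).erase v) \ G.neighborFinset v).image fun u => s(v, u) := by
    ext e
    simp only [availableAt, mem_filter, mem_image, mem_sdiff, mem_erase,
      SimpleGraph.mem_neighborFinset]
    constructor
    · rintro ⟨he, hve⟩
      obtain ⟨u, rfl⟩ := Sym2.mem_iff_exists.1 hve
      obtain ⟨h1, h2, h3⟩ := mem_available.1 he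
      refine ⟨u, ⟨⟨?_, mem_unsat.2 (h3 u (by simp))⟩, by simpa using h2⟩, rfl⟩
      simpa [eq_comm] using h1
    · rintro ⟨u, ⟨⟨h1, h2⟩, h3⟩, rfl⟩
      refine ⟨mem_available.2 ⟨by simpa [eq_comm] using h1, by simpa using h3, ?_⟩, by simp⟩
      intro w hw
      rcases Sym2.mem_iff.1 hw with rfl | rfl
      · exact mem_unsat.1 hv
      · exact mem_unsat.1 h2
  have hc : #(availableAt d G v) = #(((unsat d G).erase v) \ G.neighborFinset v) := by
    rw [h, card_image_of_injective]
    exact fun a b hab => Sym2.congr_right.1 hab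
  have h1 : #((unsat d G).erase v) + 1 = #(unsat d G) := card_erase_add_one hv
  have h2 : #(((unsat d G).erase v) \ G.neighborFinset v) ≤ #((unsat d G).erase v) :=
    card_le_card sdiff_subset
  have h3 := le_card_sdiff (G.neighborFinset v) ((unsat d G).erase v)
  have h4 : #(G.neighborFinset v) < d := by
    have := mem_unsat.1 hv
    unfold deg at this
    rwa [← SimpleGraph.card_neighborFinset_eq_degree] at this
  omega

theorem sum_card_availableAt (d : ℕ) (G : SimpleGraph V) :
    ∑ v, #(availableAt d G v) = 2 * #(available d G) := by
  classical
  simp only [availableAt, card_filter]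
  rw [sum_comm, sum_congr rfl fun e he => sum_mem_eq_two (mem_available.1 he).1]
  simp [mul_comm]

theorem card_available_bounds (d : ℕ) (G : SimpleGraph V) :
    2 * #(available d G) + #(unsat d G) ≤ #(unsat d G) * #(unsat d G) ∧
      #(unsat d G) * #(unsat d G) ≤ 2 * #(available d G) + #(unsat d G) * d := by
  have h : ∑ v ∈ unsat d G, #(availableAt d G v) = 2 * #(available d G) := by
    rw [← sum_card_availableAt]
    refine sum_subset (subset_univ _) fun v _ hv => ?_
    rw [availableAt_eq_empty hv, card_empty]
  constructor
  · have := sum_le_sum fun v (hv : v ∈ unsat d G) => (card_availableAt hv).1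
    simpa [sum_add_distrib, h] using this
  · have := sum_le_sum fun v (hv : v ∈ unsat d G) => (card_availableAt hv).2
    simpa [sum_add_distrib, h] using this

/-- The number of available pairs containing both `u` and `v` is at most one. -/
theorem card_availableAt_inter_le {d : ℕ} {G : SimpleGraph V} {u v : V} (huv : u ≠ v) :
    ∑ e ∈ available d G, (open Classical in if u ∈ e ∧ v ∈ e then (1 : ℝ) else 0) ≤ 1 := by
  classical
  have : ∀ e : Sym2 V, (if u ∈ e ∧ v ∈ e then (1 : ℝ) else 0) = if e = s(u, v) then 1 else 0 := by
    intro e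
    simp only [Sym2.mem_and_mem_iff huv]
  simp only [this, sum_ite_eq']
  split_ifs <;> norm_num

/-- The probability that the next edge contains `v`. -/
def hitProb (d : ℕ) (G : SimpleGraph V) (v : V) : ℝ :=
  (#(availableAt d G v) : ℝ) / #(available d G)

theorem hitProb_nonneg (d : ℕ) (G : SimpleGraph V) (v : V) : 0 ≤ hitProb d G v := by
  unfold hitProb; positivity

theorem hitProb_eq_zero {d : ℕ} {G : SimpleGraph V} {v : V} (hv : v ∉ unsat d G) :
    hitProb d G v = 0 := by
  simp [hitProb, availableAt_eq_empty hv]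

/-- The number of unsaturated vertices, as a real number. -/
def free (d : ℕ) (G : SimpleGraph V) : ℝ := #(unsat d G)

theorem free_nonneg (d : ℕ) (G : SimpleGraph V) : 0 ≤ free d G := by
  unfold free; positivity

theorem available_real_bounds (d : ℕ) (G : SimpleGraph V) :
    2 * (#(available d G) : ℝ) ≤ free d G * (free d G - 1) ∧
      free d G * (free d G - d) ≤ 2 * (#(available d G) : ℝ) := by
  obtain ⟨h1, h2⟩ := card_available_bounds d G
  unfold free
  constructor
  · have : (2 * #(available d G) + #(unsat d G) : ℝ) ≤ #(unsat d G) * #(unsat d G) := by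
      exact_mod_cast h1
    linarith
  · have : (#(unsat d G) * #(unsat d G) : ℝ) ≤ 2 * #(available d G) + #(unsat d G) * d := by
      exact_mod_cast h2
    linarith

theorem card_available_lower {d : ℕ} {G : SimpleGraph V} (hU : 2 * (d : ℝ) ≤ free d G) :
    free d G ^ 2 ≤ 4 * (#(available d G) : ℝ) := by
  have h2 := (available_real_bounds d G).2
  have hU0 := free_nonneg d G
  nlinarith

theorem available_pos {d : ℕ} {G : SimpleGraph V} (hd : 1 ≤ d) (hU : 2 * (d : ℝ) ≤ free d G) :
    0 < (#(available d G) : ℝ) := by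
  have h := card_available_lower hU
  have : (1 : ℝ) ≤ d := by exact_mod_cast hd
  nlinarith

/-- The probability is a quotient `a / A` with `U - d ≤ a ≤ U - 1` and `U (U - d) ≤ 2 A ≤ U (U -
1)`. -/
theorem hitProb_bounds {d : ℕ} {G : SimpleGraph V} (hd : 1 ≤ d) (hU : 2 * (d : ℝ) ≤ free d G)
    {v : V} (hv : v ∈ unsat d G) :
    2 / free d G * (1 - d / free d G) ≤ hitProb d G v ∧
      hitProb d G v ≤ 2 / free d G * (1 + 2 * d / free d G) := by
  obtain ⟨a1, a2⟩ := card_availableAt hv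
  have a1' : (#(availableAt d G v) : ℝ) + 1 ≤ free d G := by unfold free; exact_mod_cast a1
  have a2' : free d G ≤ (#(availableAt d G v) : ℝ) + d := by unfold free; exact_mod_cast a2
  obtain ⟨b1, b2⟩ := available_real_bounds d G
  have hA := available_pos hd hU
  have hd' : (1 : ℝ) ≤ d := by exact_mod_cast hd
  have hUp : 0 < free d G := by linarith
  unfold hitProb
  set U := free d G
  set A := (#(available d G) : ℝ)
  set a := (#(availableAt d G v) : ℝ)
  constructor
  · rw [le_div_iff₀ hA]
    have : 2 / U * (1 - d / U) * A = (U - d) / U ^ 2 * (2 * A) := by field_simp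
    rw [this]
    calc (U - d) / U ^ 2 * (2 * A) ≤ (U - d) / U ^ 2 * U ^ 2 := by
          apply mul_le_mul_of_nonneg_left _ (div_nonneg (by linarith) (by positivity))
          nlinarith
      _ = U - d := by field_simp
      _ ≤ a := by linarith
  · rw [div_le_iff₀ hA]
    have : 2 / U * (1 + 2 * d / U) * A = (U + 2 * d) / U ^ 2 * (2 * A) := by field_simp
    rw [this]
    have h3 : (U + 2 * d) / U ^ 2 * (U * (U - d)) ≤ (U + 2 * d) / U ^ 2 * (2 * A) :=
      mul_le_mul_of_nonneg_left b2 (by positivity)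
    refine le_trans ?_ h3
    rw [div_mul_eq_mul_div, le_div_iff₀ (by positivity)]
    have : a * U ^ 2 ≤ (U - 1) * U ^ 2 := mul_le_mul_of_nonneg_right (by linarith) (by positivity)
    -- Uses `(U + 2d)(U - d) = U² + d(U - 2d)`, which is where `U ≥ 2d` enters.
    nlinarith [mul_nonneg hUp.le (mul_nonneg (by linarith : (0:ℝ) ≤ d) (by linarith : 0 ≤ U - 2 * d))]

theorem abs_hitProb_sub_le {d : ℕ} {G : SimpleGraph V} (hd : 1 ≤ d) (hU : 2 * (d : ℝ) ≤ free d G)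
    {v : V} (hv : v ∈ unsat d G) : |hitProb d G v - 2 / free d G| ≤ 4 * d / free d G ^ 2 := by
  obtain ⟨h1, h2⟩ := hitProb_bounds hd hU hv
  have hd' : (1 : ℝ) ≤ d := by exact_mod_cast hd
  have hUp : 0 < free d G := by linarith
  have e1 : 2 / free d G * (1 - d / free d G) = 2 / free d G - 2 * d / free d G ^ 2 := by
    field_simp
  have e2 : 2 / free d G * (1 + 2 * d / free d G) = 2 / free d G + 4 * d / free d G ^ 2 := by
    field_simp; ring
  rw [e1] at h1
  rw [e2] at h2
  have : 2 * d / free d G ^ 2 ≤ 4 * d / free d G ^ 2 := by gcongr; norm_num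
  rw [abs_le]
  constructor <;> linarith

/-- The expectation of `φ` after one step of the process from `G`. -/
def stepExp (d : ℕ) (G : SimpleGraph V) (φ : SimpleGraph V → ℝ) : ℝ :=
  open Classical in
  if (available d G).Nonempty then
    (∑ e ∈ available d G, φ (addEdge G e)) / #(available d G)
  else φ G

theorem stepExp_mono {d : ℕ} {G : SimpleGraph V} {φ ψ : SimpleGraph V → ℝ}
    (h : ∀ e ∈ available d G, φ (addEdge G e) ≤ ψ (addEdge G e))
    (h' : ¬ (available d G).Nonempty → φ G ≤ ψ G) :
    stepExp d G φ ≤ stepExp d G ψ := by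
  unfold stepExp
  split_ifs with hA
  · gcongr with e he
    exact h e he
  · exact h' hA

theorem stepExp_add (d : ℕ) (G : SimpleGraph V) (φ ψ : SimpleGraph V → ℝ) :
    stepExp d G (fun H => φ H + ψ H) = stepExp d G φ + stepExp d G ψ := by
  unfold stepExp
  split_ifs <;> simp [sum_add_distrib, add_div]

theorem stepExp_const_mul (d : ℕ) (G : SimpleGraph V) (c : ℝ) (φ : SimpleGraph V → ℝ) :
    stepExp d G (fun H => c * φ H) = c * stepExp d G φ := by
  unfold stepExp
  split_ifs <;> simp [← mul_sum, mul_div_assoc]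

theorem stepExp_const (d : ℕ) (G : SimpleGraph V) (c : ℝ) : stepExp d G (fun _ => c) = c := by
  unfold stepExp
  split_ifs with h
  · have : (#(available d G) : ℝ) ≠ 0 := by exact_mod_cast h.card_pos.ne'
    simp [this]
  · rfl

theorem stepExp_sum {ι : Type*} (d : ℕ) (G : SimpleGraph V) (s : Finset ι)
    (φ : ι → SimpleGraph V → ℝ) :
    stepExp d G (fun H => ∑ i ∈ s, φ i H) = ∑ i ∈ s, stepExp d G (φ i) := by
  classical
  induction s using Finset.induction_on with
  | empty => simp [stepExp_const]
  | insert a s ha ih => simp [sum_insert ha, stepExp_add, ih]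

theorem stepExp_deg {d : ℕ} {G : SimpleGraph V} (hA : (available d G).Nonempty) (f : ℕ → ℝ)
    (v : V) :
    stepExp d G (fun H => f (deg H v)) =
      f (deg G v) + hitProb d G v * (f (deg G v + 1) - f (deg G v)) := by
  classical
  have hA' : (#(available d G) : ℝ) ≠ 0 := by exact_mod_cast hA.card_pos.ne'
  unfold stepExp hitProb availableAt
  rw [if_pos hA, card_filter, Nat.cast_sum]
  have : ∀ e ∈ available d G, f (deg (addEdge G e) v) =
      f (deg G v) + ((if v ∈ e then 1 else 0 : ℕ) : ℝ) * (f (deg G v + 1) - f (deg G v)) := by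
    intro e he
    rw [deg_addEdge he]
    split_ifs <;> simp
  rw [sum_congr rfl this, sum_add_distrib, ← sum_mul]
  simp only [sum_const, nsmul_eq_mul]
  field_simp

theorem stepExp_sum_deg {d : ℕ} {G : SimpleGraph V} (hA : (available d G).Nonempty) (f : ℕ → ℝ) :
    stepExp d G (fun H => ∑ v, f (deg H v)) =
      ∑ v, (f (deg G v) + hitProb d G v * (f (deg G v + 1) - f (deg G v))) := by
  rw [stepExp_sum]
  exact sum_congr rfl fun v _ => stepExp_deg hA f v

/-- To first order the two factors change separately. Both change only if the new edge is the pair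
`u v` itself, an event of probability at most `1 / #(available d G)`, and then the correction `(x -
x') (y - y')` is at most `x y`. -/
theorem stepExp_deg_mul_le {d : ℕ} {G : SimpleGraph V} (hA : (available d G).Nonempty)
    {a b : ℕ → ℝ} (ha : Antitone a) (hb : Antitone b) (ha0 : ∀ i, 0 ≤ a i) (hb0 : ∀ i, 0 ≤ b i)
    {u v : V} (huv : u ≠ v) :
    stepExp d G (fun H => a (deg H u) * b (deg H v)) ≤
      a (deg G u) * b (deg G v)
        + hitProb d G u * (a (deg G u + 1) - a (deg G u)) * b (deg G v)
        + hitProb d G v * (b (deg G v + 1) - b (deg G v)) * a (deg G u)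
        + a (deg G u) * b (deg G v) / #(available d G) := by
  classical
  have hA' : (#(available d G) : ℝ) ≠ 0 := by exact_mod_cast hA.card_pos.ne'
  have hA'' : (0 : ℝ) < #(available d G) := by exact_mod_cast hA.card_pos
  unfold stepExp hitProb availableAt
  rw [if_pos hA, card_filter, card_filter, Nat.cast_sum, Nat.cast_sum]
  set x := a (deg G u)
  set y := b (deg G v)
  set x' := a (deg G u + 1) with hx'
  set y' := b (deg G v + 1) with hy'
  have hx : x' ≤ x := ha (Nat.le_succ _)
  have hy : y' ≤ y := hb (Nat.le_succ _)
  have hx0 : 0 ≤ x' := ha0 _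
  have hy0 : 0 ≤ y' := hb0 _
  have key : ∀ e ∈ available d G, a (deg (addEdge G e) u) * b (deg (addEdge G e) v) ≤
      x * y + ((if u ∈ e then 1 else 0 : ℕ) : ℝ) * ((x' - x) * y)
        + ((if v ∈ e then 1 else 0 : ℕ) : ℝ) * ((y' - y) * x)
        + (if u ∈ e ∧ v ∈ e then 1 else 0 : ℝ) * (x * y) := by
    intro e he
    rw [deg_addEdge he, deg_addEdge he]
    by_cases h1 : u ∈ e <;> by_cases h2 : v ∈ e <;> simp only [h1, h2, if_true, if_false, and_self,
      and_true, and_false, add_zero, ← hx', ← hy', Nat.cast_one, Nat.cast_zero]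
    · nlinarith
    · change x' * y ≤ _; nlinarith
    · change x * y' ≤ _; nlinarith
    · change x * y ≤ _; nlinarith
  have h2 := sum_le_sum key
  simp only [sum_add_distrib, ← sum_mul, sum_const, nsmul_eq_mul] at h2
  have h3 := mul_le_mul_of_nonneg_right (card_availableAt_inter_le (d := d) (G := G) huv)
    (mul_nonneg (hx0.trans hx) (hy0.trans hy))
  rw [div_le_iff₀ hA'']
  refine h2.trans ?_
  field_simp
  nlinarith

end Combinatorics

end RandomDGraph

end

/-! ### The process with its clock, reachable states and deterministic bounds. -/

noncomputable section

namespace RandomDGraph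

open Finset

section Clock

variable {V : Type*} [Fintype V]

/-- One step of the process which carries along the clock that advances by `2 / U` in each step,
`U` being the number of unsaturated vertices, acting on functions. -/
def clockStep (d : ℕ) (φ : SimpleGraph V → ℝ → ℝ) (G : SimpleGraph V) (X : ℝ) : ℝ :=
  stepExp d G fun H => φ H (X + 2 / free d G)

/-- The expectation of a function of the graph and of the clock after `s` steps. -/
def expAt (d s : ℕ) (φ : SimpleGraph V → ℝ → ℝ) : ℝ := (clockStep d)^[s] φ ⊥ 0

theorem expAt_zero (d : ℕ) (φ : SimpleGraph V → ℝ → ℝ) : expAt d 0 φ = φ ⊥ 0 := rfl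

theorem expAt_succ (d s : ℕ) (φ : SimpleGraph V → ℝ → ℝ) :
    expAt d (s + 1) φ = expAt d s (clockStep d φ) := rfl

/-- The states which the process with clock can reach in `s` steps. -/
inductive Reach (d : ℕ) : ℕ → SimpleGraph V → ℝ → Prop
  | zero : Reach d 0 ⊥ 0
  | succ {s : ℕ} {G : SimpleGraph V} {X : ℝ} {e : Sym2 V} :
      Reach d s G X → e ∈ available d G → Reach d (s + 1) (addEdge G e) (X + 2 / free d G)
  | stuck {s : ℕ} {G : SimpleGraph V} {X : ℝ} :
      Reach d s G X → ¬ (available d G).Nonempty → Reach d (s + 1) G (X + 2 / free d G)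

/-- Restricting the comparison to reachable states allows every deterministic invariant of `Reach`
to be used inside an expectation. -/
theorem expAt_mono {d s : ℕ} {φ ψ : SimpleGraph V → ℝ → ℝ}
    (h : ∀ G X, Reach d s G X → φ G X ≤ ψ G X) : expAt d s φ ≤ expAt d s ψ := by
  induction s generalizing φ ψ with
  | zero => exact h _ _ Reach.zero
  | succ s ih =>
    rw [expAt_succ, expAt_succ]
    exact ih fun G X hR => stepExp_mono (fun e he => h _ _ (hR.succ he)) fun h0 => h _ _ (hR.stuck h0)

theorem expAt_add (d s : ℕ) (φ ψ : SimpleGraph V → ℝ → ℝ) :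
    expAt d s (fun G X => φ G X + ψ G X) = expAt d s φ + expAt d s ψ := by
  induction s generalizing φ ψ with
  | zero => rfl
  | succ s ih =>
    rw [expAt_succ, expAt_succ, expAt_succ, ← ih]
    congr 1
    funext G X
    exact stepExp_add _ _ _ _

theorem expAt_const_mul (d s : ℕ) (c : ℝ) (φ : SimpleGraph V → ℝ → ℝ) :
    expAt d s (fun G X => c * φ G X) = c * expAt d s φ := by
  induction s generalizing φ with
  | zero => rfl
  | succ s ih =>
    rw [expAt_succ, expAt_succ, ← ih]
    congr 1
    funext G X
    exact stepExp_const_mul _ _ _ _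

theorem expAt_const (d s : ℕ) (c : ℝ) : expAt d s (fun (_ : SimpleGraph V) _ => c) = c := by
  induction s with
  | zero => rfl
  | succ s ih =>
    rw [expAt_succ]
    have : clockStep d (fun (_ : SimpleGraph V) _ => c) = fun _ _ => c := by
      funext G X
      exact stepExp_const _ _ _
    rw [this, ih]

theorem expAt_nonneg {d s : ℕ} {φ : SimpleGraph V → ℝ → ℝ} (h : ∀ G X, 0 ≤ φ G X) :
    0 ≤ expAt d s φ := by
  rw [← expAt_const (V := V) d s 0]
  exact expAt_mono fun G X _ => h G X

/-- The total number of missing degrees after `s` steps. -/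
def deficit (V : Type*) [Fintype V] (d s : ℕ) : ℝ := d * Fintype.card V - 2 * s

theorem deficit_succ (d s : ℕ) : deficit V d (s + 1) = deficit V d s - 2 := by
  unfold deficit; push_cast; ring

theorem deficit_zero (d : ℕ) : deficit V d 0 = d * Fintype.card V := by
  simp [deficit]

theorem Reach.deg_le {d s : ℕ} {G : SimpleGraph V} {X : ℝ} (h : Reach d s G X) (v : V) :
    deg G v ≤ d := by
  classical
  induction h with
  | zero => simp [deg_bot]
  | succ h he ih =>
    rw [deg_addEdge he]
    split_ifs with hv
    · exact (mem_available.1 he).2.2 v hv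
    · simpa using ih
  | stuck h h0 ih => exact ih

theorem sum_missing_eq {d : ℕ} {G : SimpleGraph V} (h : ∀ v, deg G v ≤ d) :
    ∑ v, ((d : ℝ) - deg G v) = ∑ v ∈ unsat d G, ((d : ℝ) - deg G v) := by
  symm
  refine sum_subset (subset_univ _) fun v _ hv => ?_
  have : deg G v = d := le_antisymm (h v) (by simpa [mem_unsat] using hv)
  simp [this]

theorem free_le_sum_missing {d : ℕ} {G : SimpleGraph V} (h : ∀ v, deg G v ≤ d) :
    free d G ≤ ∑ v, ((d : ℝ) - deg G v) := by
  rw [sum_missing_eq h, free, card_eq_sum_ones, Nat.cast_sum]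
  refine sum_le_sum fun v hv => ?_
  have : deg G v + 1 ≤ d := mem_unsat.1 hv
  have : (deg G v + 1 : ℝ) ≤ d := by exact_mod_cast this
  push_cast; linarith

theorem sum_missing_le {d : ℕ} {G : SimpleGraph V} (h : ∀ v, deg G v ≤ d) :
    ∑ v, ((d : ℝ) - deg G v) ≤ d * free d G := by
  rw [sum_missing_eq h, free, card_eq_sum_ones, Nat.cast_sum, mul_sum]
  refine sum_le_sum fun v hv => ?_
  simp

theorem available_nonempty {d : ℕ} {G : SimpleGraph V} (hd : 1 ≤ d) (hU : 2 * (d : ℝ) ≤ free d G) :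
    (available d G).Nonempty := by
  rw [← card_pos]
  exact_mod_cast available_pos hd hU

theorem Reach.sum_missing {d s : ℕ} {G : SimpleGraph V} {X : ℝ} (hd : 1 ≤ d) (h : Reach d s G X)
    (hs : 2 * (d : ℝ) ^ 2 ≤ deficit V d s) : ∑ v, ((d : ℝ) - deg G v) = deficit V d s := by
  classical
  have hd' : (1 : ℝ) ≤ d := by exact_mod_cast hd
  induction h with
  | zero => simp [deg_bot, deficit, mul_comm]
  | @succ s G X e h he ih =>
    rw [deficit_succ] at hs ⊢
    rw [← ih (by linarith)]
    have h2 : ∑ v : V, (if v ∈ e then (1 : ℝ) else 0) = 2 := by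
      exact_mod_cast sum_mem_eq_two (mem_available.1 he).1
    rw [← h2, ← sum_sub_distrib]
    refine sum_congr rfl fun v _ => ?_
    rw [deg_addEdge he]
    split_ifs <;> push_cast <;> ring
  -- The process cannot be stuck this early: missing degrees totalling at least `2 d ^ 2` force `U ≥
  -- 2 d`, and then some pair is available.
  | @stuck s G X h h0 ih =>
    rw [deficit_succ] at hs
    have h1 := ih (by linarith)
    have h2 := sum_missing_le h.deg_le
    refine absurd (available_nonempty hd ?_) h0
    rw [h1] at h2
    nlinarith

section Late

variable {d s : ℕ} {G : SimpleGraph V} {X : ℝ}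

theorem Reach.free_le (h : Reach d s G X) (hd : 1 ≤ d) (hs : 2 * (d : ℝ) ^ 2 ≤ deficit V d s) :
    free d G ≤ deficit V d s := by
  rw [← h.sum_missing hd hs]
  exact free_le_sum_missing h.deg_le

theorem Reach.deficit_le (h : Reach d s G X) (hd : 1 ≤ d) (hs : 2 * (d : ℝ) ^ 2 ≤ deficit V d s) :
    deficit V d s ≤ d * free d G := by
  rw [← h.sum_missing hd hs]
  exact sum_missing_le h.deg_le

theorem Reach.le_free (h : Reach d s G X) (hd : 1 ≤ d) (hs : 2 * (d : ℝ) ^ 2 ≤ deficit V d s) :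
    2 * (d : ℝ) ≤ free d G := by
  have hd' : (1 : ℝ) ≤ d := by exact_mod_cast hd
  have := h.deficit_le hd hs
  nlinarith

theorem Reach.one_div_free_le (h : Reach d s G X) (hd : 1 ≤ d)
    (hs : 2 * (d : ℝ) ^ 2 ≤ deficit V d s) : 1 / free d G ≤ d / deficit V d s := by
  have hd' : (1 : ℝ) ≤ d := by exact_mod_cast hd
  have h1 := h.le_free hd hs
  have h2 := h.deficit_le hd hs
  rw [div_le_div_iff₀ (by linarith) (by nlinarith)]
  linarith

theorem Reach.hitProb_ge (h : Reach d s G X) (hd : 1 ≤ d) (hs : 2 * (d : ℝ) ^ 2 ≤ deficit V d s)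
    {v : V} (hv : v ∈ unsat d G) :
    2 / deficit V d s * (1 - d ^ 2 / deficit V d s) ≤ hitProb d G v := by
  have hd' : (1 : ℝ) ≤ d := by exact_mod_cast hd
  have hU := h.le_free hd hs
  refine le_trans ?_ (hitProb_bounds hd hU hv).1
  have h1 : 2 / deficit V d s ≤ 2 / free d G :=
    div_le_div_of_nonneg_left (by norm_num) (by linarith) (h.free_le hd hs)
  have h2 : (d : ℝ) / free d G ≤ d ^ 2 / deficit V d s := by
    have := mul_le_mul_of_nonneg_left (h.one_div_free_le hd hs) (by linarith : (0 : ℝ) ≤ d)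
    calc (d : ℝ) / free d G = d * (1 / free d G) := by ring
      _ ≤ _ := this
      _ = _ := by ring
  have h3 : (d : ℝ) ^ 2 / deficit V d s ≤ 1 := by
    rw [div_le_one (by nlinarith)]; nlinarith
  have h4 : 0 ≤ 2 / free d G := div_nonneg (by norm_num) (free_nonneg _ _)
  exact mul_le_mul h1 (by linarith) (by linarith) h4

end Late

theorem pos_of_two_mul_sq_le {d : ℕ} (hd : 1 ≤ d) {ρ : ℝ} (h : 2 * (d : ℝ) ^ 2 ≤ ρ) : 2 ≤ ρ := by
  have hd' : (1 : ℝ) ≤ d := by exact_mod_cast hd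
  nlinarith

/-- The clock lies between two logarithmic bounds. -/
theorem Reach.clock_bounds {d s : ℕ} {G : SimpleGraph V} {X : ℝ} (hd : 1 ≤ d) (h : Reach d s G X)
    (hs : 2 * (d : ℝ) ^ 2 ≤ deficit V d s) :
    Real.log ((deficit V d 0 + 2) / (deficit V d s + 2)) ≤ X ∧
      X ≤ d * Real.log (deficit V d 0 / deficit V d s) := by
  classical
  -- Since `ρ / d ≤ U ≤ ρ`, the increment `2 / U` lies between `2 / ρ` and `2 d / ρ`. The shift by 2
  -- in the lower bound makes its logarithmic increment `log ((ρ + 2) / ρ)`, which is at most `2 /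
  -- ρ`; the unshifted one, `log (ρ / (ρ - 2))`, is at least `2 / ρ`, as the upper bound requires.
  have aux : ∀ {s : ℕ} {G : SimpleGraph V} {X : ℝ}, Reach d s G X →
      2 * (d : ℝ) ^ 2 ≤ deficit V d s - 2 →
      (Real.log ((deficit V d 0 + 2) / (deficit V d s + 2)) ≤ X ∧
      X ≤ d * Real.log (deficit V d 0 / deficit V d s)) →
      Real.log ((deficit V d 0 + 2) / (deficit V d s - 2 + 2)) ≤ X + 2 / free d G ∧
      X + 2 / free d G ≤ d * Real.log (deficit V d 0 / (deficit V d s - 2)) := by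
    intro s G X h hs ⟨i1, i2⟩
    have hd' : (1 : ℝ) ≤ d := by exact_mod_cast hd
    have h2 : 2 ≤ deficit V d s - 2 := pos_of_two_mul_sq_le hd hs
    have hf := h.free_le hd (by linarith)
    have hu := h.one_div_free_le hd (by linarith)
    have hU := h.le_free hd (by linarith)
    have h0 : deficit V d s ≤ deficit V d 0 := by
      unfold deficit; have : (0 : ℝ) ≤ s := by positivity
      push_cast; linarith
    set ρ := deficit V d s
    set ρ₀ := deficit V d 0
    have hρ : 0 < ρ := by linarith
    have hρ₀ : 0 < ρ₀ := by linarith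
    constructor
    · have e : Real.log ((ρ₀ + 2) / (ρ - 2 + 2)) =
          Real.log ((ρ₀ + 2) / (ρ + 2)) + Real.log ((ρ + 2) / ρ) := by
        rw [← Real.log_mul (by positivity) (by positivity)]
        congr 1
        field_simp
        ring
      have l1 := Real.log_le_sub_one_of_pos (show 0 < (ρ + 2) / ρ by positivity)
      have l2 : (ρ + 2) / ρ - 1 = 2 / ρ := by field_simp; ring
      have l3 : 2 / ρ ≤ 2 / free d G := div_le_div_of_nonneg_left (by norm_num) (by linarith) hf
      linarith
    · have e : Real.log (ρ₀ / (ρ - 2)) = Real.log (ρ₀ / ρ) - Real.log ((ρ - 2) / ρ) := by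
        have : ρ - 2 ≠ 0 := by linarith
        rw [← Real.log_div (by positivity) (by positivity)]
        congr 1
        field_simp
      have hp : 0 < ρ - 2 := by linarith
      have l1 := Real.log_le_sub_one_of_pos (show 0 < (ρ - 2) / ρ by positivity)
      have l2 : (ρ - 2) / ρ - 1 = -(2 / ρ) := by field_simp; ring
      have l3 : 2 / free d G ≤ d * (2 / ρ) := by
        calc 2 / free d G = 2 * (1 / free d G) := by ring
          _ ≤ 2 * (d / ρ) := by linarith
          _ = _ := by ring
      rw [e, mul_sub]
      nlinarith
  induction h with
  | zero =>
    have := pos_of_two_mul_sq_le hd hs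
    rw [div_self (by linarith), div_self (by linarith)]
    simp
  | @succ s G X e h he ih =>
    rw [deficit_succ] at hs ⊢
    exact aux h hs (ih (by linarith))
  | @stuck s G X h h0 ih =>
    rw [deficit_succ] at hs ⊢
    exact aux h hs (ih (by linarith))

end Clock

/-! ### Identification with the law of the process. -/

section Law

/-- For functions of the graph alone, `expAt` is the expectation under the law of the process. -/
theorem expAt_graph_eq (d n s : ℕ) (ψ : SimpleGraph (Fin n) → ℝ) :
    expAt d s (fun G _ => ψ G) = ∑ G, (graphLaw d n s G).toReal * ψ G := by
  classical
  induction s generalizing ψ with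
  | zero =>
    rw [expAt_zero]
    simp [graphLaw, PMF.pure_apply, apply_ite ENNReal.toReal]
  | succ s ih =>
    rw [expAt_succ]
    have hstep : ∀ G : SimpleGraph (Fin n),
        stepExp d G ψ = ∑ H, (step d G H).toReal * ψ H := by
      intro G
      unfold stepExp step
      split_ifs with h
      · have hc : (#(available d G) : ℝ) ≠ 0 := by exact_mod_cast h.card_pos.ne'
        have : ∀ H, ((PMF.uniformOfFinset (available d G) h).map
            (fun e => G ⊔ SimpleGraph.fromEdgeSet {e}) H).toReal =
            ∑ e ∈ available d G, if H = addEdge G e then (#(available d G) : ℝ)⁻¹ else 0 := by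
          intro H
          rw [PMF.map_apply, tsum_fintype, ENNReal.toReal_sum]
          · rw [← sum_subset (subset_univ (available d G))]
            · refine sum_congr rfl fun e he => ?_
              by_cases hH : H = addEdge G e
              · rw [if_pos hH, if_pos (show H = G ⊔ _ from hH), PMF.uniformOfFinset_apply_of_mem _ he]; simp
              · rw [if_neg hH, if_neg (show ¬ H = G ⊔ _ from hH), ENNReal.toReal_zero]
            · intro e _ he
              rw [PMF.uniformOfFinset_apply_of_notMem _ he]; simp
          · intro e _
            split_ifs
            · exact PMF.apply_ne_top _ _
            · simp
        simp_rw [this, sum_mul]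
        rw [sum_comm, div_eq_mul_inv, sum_mul]
        refine sum_congr rfl fun e _ => ?_
        simp [mul_comm]
      · simp [PMF.pure_apply, apply_ite ENNReal.toReal]
    have : clockStep d (fun G (_ : ℝ) => ψ G) = fun G _ => ∑ H, (step d G H).toReal * ψ H := by
      funext G X
      exact hstep G
    rw [this, ih]
    have h2 : ∀ H, (graphLaw d n (s + 1) H).toReal =
        ∑ G, (graphLaw d n s G).toReal * (step d G H).toReal := by
      intro H
      change ((graphLaw d n s).bind (step d) H).toReal = _
      rw [PMF.bind_apply, tsum_fintype, ENNReal.toReal_sum]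
      · simp
      · intro G _
        exact ENNReal.mul_ne_top (PMF.apply_ne_top _ _) (PMF.apply_ne_top _ _)
    simp_rw [h2, mul_sum, sum_mul]
    rw [sum_comm]
    refine sum_congr rfl fun H _ => sum_congr rfl fun G _ => by ring

open Classical in
/-- The number of vertices of degree `j`, as a real number. -/
def degCount {V : Type*} [Fintype V] (j : ℕ) (G : SimpleGraph V) : ℝ :=
  ∑ v, if deg G v = j then 1 else 0

theorem degCount_eq {V : Type*} [Fintype V] (j : ℕ) (G : SimpleGraph V) :
    degCount j G = degreeCount j G := by
  classical
  unfold degCount degreeCount deg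
  rw [card_filter, Nat.cast_sum]
  refine sum_congr rfl fun v _ => ?_
  by_cases h : G.degree v = j <;> simp [h]

theorem degreeCountLaw_one (d n j t : ℕ) :
    (degreeCountLaw d n j t 1).toReal =
      expAt d (maxEdges d n - t)
        (fun (G : SimpleGraph (Fin n)) _ => if degreeCount j G = 1 then 1 else 0) := by
  classical
  rw [expAt_graph_eq, degreeCountLaw, PMF.map_apply, tsum_fintype, ENNReal.toReal_sum]
  · refine sum_congr rfl fun G _ => ?_
    by_cases h : degreeCount j G = 1
    · simp [h]
    · rw [if_neg (Ne.symm h)]; simp [h]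
  · intro G _
    split_ifs
    · exact PMF.apply_ne_top _ _
    · simp

end Law

end RandomDGraph

end

/-! ### Second phase: decay of geometric weights, pair weights and degree counts. -/

noncomputable section

namespace RandomDGraph

open Finset

section Weights

variable {V : Type*} [Fintype V]

/-- The sum of a weight of the degrees over all vertices. -/
def weight (a : ℕ → ℝ) (G : SimpleGraph V) : ℝ := ∑ v, a (deg G v)

open Classical in
/-- The sum of the product of two weights of the degrees over all ordered pairs of distinct
vertices. -/
def pairWeight (a b : ℕ → ℝ) (G : SimpleGraph V) : ℝ :=
  ∑ u, ∑ v ∈ univ.erase u, a (deg G u) * b (deg G v)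

/-- A nonnegative weight on degrees that vanishes for saturated vertices and shrinks by a factor
of `θ` when the degree grows by one. -/
structure Geometric (d : ℕ) (θ : ℝ) (a : ℕ → ℝ) : Prop where
  nonneg : ∀ i, 0 ≤ a i
  shrink : ∀ i, a (i + 1) ≤ a i / θ
  zero : ∀ i, d ≤ i → a i = 0

theorem Geometric.antitone {d : ℕ} {θ : ℝ} {a : ℕ → ℝ} (h : Geometric d θ a) (hθ : 1 ≤ θ) :
    Antitone a :=
  antitone_nat_of_succ_le fun i => (h.shrink i).trans (div_le_self (h.nonneg i) hθ)

theorem weight_nonneg {a : ℕ → ℝ} (h : ∀ i, 0 ≤ a i) (G : SimpleGraph V) : 0 ≤ weight a G :=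
  sum_nonneg fun _ _ => h _

theorem pairWeight_nonneg {a b : ℕ → ℝ} (ha : ∀ i, 0 ≤ a i) (hb : ∀ i, 0 ≤ b i)
    (G : SimpleGraph V) : 0 ≤ pairWeight a b G :=
  sum_nonneg fun _ _ => sum_nonneg fun _ _ => mul_nonneg (ha _) (hb _)

theorem pairWeight_le {a b : ℕ → ℝ} (ha : ∀ i, 0 ≤ a i) (hb : ∀ i, 0 ≤ b i) (G : SimpleGraph V) :
    pairWeight a b G ≤ weight a G * weight b G := by
  classical
  unfold pairWeight weight
  rw [sum_mul_sum]
  exact sum_le_sum fun u _ => sum_le_sum_of_subset_of_nonneg (subset_univ _)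
    fun v _ _ => mul_nonneg (ha _) (hb _)

theorem weight_mul_weight (a b : ℕ → ℝ) (G : SimpleGraph V) :
    weight a G * weight b G = pairWeight a b G + ∑ v, a (deg G v) * b (deg G v) := by
  classical
  unfold pairWeight weight
  rw [sum_mul_sum, ← sum_add_distrib]
  exact sum_congr rfl fun u _ => (sum_erase_add _ _ (mem_univ u)).symm

theorem pairWeight_mono {a b a' b' : ℕ → ℝ} (ha : ∀ i, 0 ≤ a i) (hb : ∀ i, 0 ≤ b i)
    (haa : ∀ i, a i ≤ a' i) (hbb : ∀ i, b i ≤ b' i) (G : SimpleGraph V) :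
    pairWeight a b G ≤ pairWeight a' b' G :=
  sum_le_sum fun _ _ => sum_le_sum fun _ _ =>
    mul_le_mul (haa _) (hbb _) (hb _) ((ha _).trans (haa _))

variable {d s : ℕ} {G : SimpleGraph V} {X θ : ℝ} {a b : ℕ → ℝ}

/-- When hit, a vertex loses at least the fraction `1 - 1 / θ` of its weight, and an unsaturated
vertex is hit with probability at least about `2 / ρ` because `U ≤ ρ`. A saturated vertex has weight
zero. -/
theorem Geometric.hit_le (ha : Geometric d θ a) (hθ : 1 ≤ θ) (h : Reach d s G X) (hd : 1 ≤ d)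
    (hs : 2 * (d : ℝ) ^ 2 ≤ deficit V d s) (v : V) :
    hitProb d G v * (a (deg G v + 1) - a (deg G v)) ≤
      -(2 / deficit V d s * (1 - d ^ 2 / deficit V d s) * (1 - 1 / θ)) * a (deg G v) := by
  by_cases hv : v ∈ unsat d G
  · have h1 := h.hitProb_ge hd hs hv
    have h2 : a (deg G v + 1) - a (deg G v) ≤ -(1 - 1 / θ) * a (deg G v) := by
      have := ha.shrink (deg G v)
      rw [div_eq_mul_one_div] at this
      linarith
    have h3 : 0 ≤ 1 - 1 / θ := by
      rw [sub_nonneg, div_le_one (by linarith)]; exact hθ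
    have h4 := mul_nonneg h3 (ha.nonneg (deg G v))
    calc _ ≤ hitProb d G v * (-(1 - 1 / θ) * a (deg G v)) :=
          mul_le_mul_of_nonneg_left h2 (hitProb_nonneg _ _ _)
      _ = -(hitProb d G v * ((1 - 1 / θ) * a (deg G v))) := by ring
      _ ≤ -(2 / deficit V d s * (1 - d ^ 2 / deficit V d s) * ((1 - 1 / θ) * a (deg G v))) :=
          neg_le_neg (mul_le_mul_of_nonneg_right h1 h4)
      _ = _ := by ring
  · have : a (deg G v) = 0 := ha.zero _ (by simpa [mem_unsat] using hv)
    simp [hitProb_eq_zero hv, this]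

theorem stepExp_weight_le (ha : Geometric d θ a) (hθ : 1 ≤ θ) (h : Reach d s G X) (hd : 1 ≤ d)
    (hs : 2 * (d : ℝ) ^ 2 ≤ deficit V d s) :
    stepExp d G (weight a) ≤
      (1 - 2 / deficit V d s * (1 - d ^ 2 / deficit V d s) * (1 - 1 / θ)) * weight a G := by
  have hA := available_nonempty hd (h.le_free hd hs)
  have := stepExp_sum_deg hA a
  unfold weight
  rw [this, mul_sum]
  refine sum_le_sum fun v _ => ?_
  have := ha.hit_le hθ h hd hs v
  linarith

theorem Reach.one_div_available_le (h : Reach d s G X) (hd : 1 ≤ d)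
    (hs : 2 * (d : ℝ) ^ 2 ≤ deficit V d s) :
    1 / (#(available d G) : ℝ) ≤ 4 * d ^ 2 / deficit V d s ^ 2 := by
  have hU := h.le_free hd hs
  have hA := available_pos hd hU
  have h1 := card_available_lower hU
  have h2 := h.deficit_le hd hs
  have h3 := pos_of_two_mul_sq_le hd hs
  rw [div_le_div_iff₀ hA (by positivity)]
  have : deficit V d s ^ 2 ≤ (d * free d G) ^ 2 := by gcongr
  nlinarith [sq_nonneg (d : ℝ)]

theorem stepExp_pairWeight_le (ha : Geometric d θ a) (hb : Geometric d θ b) (hθ : 1 ≤ θ)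
    (h : Reach d s G X) (hd : 1 ≤ d) (hs : 2 * (d : ℝ) ^ 2 ≤ deficit V d s) :
    stepExp d G (pairWeight a b) ≤
      (1 - 4 / deficit V d s * (1 - d ^ 2 / deficit V d s) * (1 - 1 / θ)
        + 4 * d ^ 2 / deficit V d s ^ 2) * pairWeight a b G := by
  classical
  have hA := available_nonempty hd (h.le_free hd hs)
  have e : stepExp d G (pairWeight a b) =
      ∑ u, ∑ v ∈ univ.erase u, stepExp d G (fun H => a (deg H u) * b (deg H v)) := by
    change stepExp d G (fun H => ∑ u, ∑ v ∈ univ.erase u, a (deg H u) * b (deg H v)) = _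
    rw [stepExp_sum]
    exact sum_congr rfl fun u _ => by rw [stepExp_sum]
  rw [e, pairWeight, mul_sum]
  refine sum_le_sum fun u _ => ?_
  rw [mul_sum]
  refine sum_le_sum fun v hv => ?_
  have huv : u ≠ v := (ne_of_mem_erase hv).symm
  refine (stepExp_deg_mul_le hA (ha.antitone hθ) (hb.antitone hθ) ha.nonneg hb.nonneg huv).trans ?_
  have h1 := mul_le_mul_of_nonneg_right (ha.hit_le hθ h hd hs u) (hb.nonneg (deg G v))
  have h2 := mul_le_mul_of_nonneg_right (hb.hit_le hθ h hd hs v) (ha.nonneg (deg G u))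
  have h3 := mul_le_mul_of_nonneg_left (h.one_div_available_le hd hs)
    (mul_nonneg (ha.nonneg (deg G u)) (hb.nonneg (deg G v)))
  rw [div_eq_mul_one_div]
  have e4 : 4 / deficit V d s = 2 * (2 / deficit V d s) := by ring
  rw [e4]
  linarith

/-- The exponent which controls the growth of the normalised weights. -/
def growth (d : ℕ) (θ ρ : ℝ) : ℝ := -(8 / θ) * Real.log ρ + 16 * d ^ 2 / ρ

/-- The two terms of `growth` telescope to dominate `1 / (θ ρ)` and `1 / ρ ^ 2`. The factor 4 leaves
room for multiplication by `(1 - 2 / ρ) ^ 2 ≥ 1 / 4` in `pairWeight_factor_le`. -/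
theorem growth_step {d : ℕ} (hd : 1 ≤ d) {θ ρ : ℝ} (hθ : 1 ≤ θ)
    (hρ : 2 * (d : ℝ) ^ 2 ≤ ρ - 2) :
    4 * (4 / ρ * (1 / θ) + 8 * d ^ 2 / ρ ^ 2) ≤ growth d θ (ρ - 2) - growth d θ ρ := by
  have h2 := pos_of_two_mul_sq_le hd hρ
  have hp : 0 < ρ - 2 := by linarith
  have hρ0 : 0 < ρ := by linarith
  have l1 := Real.log_le_sub_one_of_pos (show 0 < (ρ - 2) / ρ by positivity)
  have l2 : (ρ - 2) / ρ - 1 = -(2 / ρ) := by field_simp; ring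
  rw [l2, Real.log_div hp.ne' hρ0.ne'] at l1
  have l3 : 2 / ρ ^ 2 ≤ 1 / (ρ - 2) - 1 / ρ := by
    have : 1 / (ρ - 2) - 1 / ρ = 2 / ((ρ - 2) * ρ) := by field_simp; ring
    rw [this]
    apply div_le_div_of_nonneg_left (by norm_num) (by positivity)
    nlinarith
  have l4 : 8 / θ * (2 / ρ) ≤ 8 / θ * (Real.log ρ - Real.log (ρ - 2)) :=
    mul_le_mul_of_nonneg_left (by linarith) (by positivity)
  have l5 : 16 * (d : ℝ) ^ 2 * (2 / ρ ^ 2) ≤ 16 * d ^ 2 * (1 / (ρ - 2) - 1 / ρ) :=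
    mul_le_mul_of_nonneg_left l3 (by positivity)
  unfold growth
  have e1 : 4 * (4 / ρ * (1 / θ) + 8 * d ^ 2 / ρ ^ 2) =
      8 / θ * (2 / ρ) + 16 * (d : ℝ) ^ 2 * (2 / ρ ^ 2) := by
    field_simp; ring
  have e2 : 16 * (d : ℝ) ^ 2 / (ρ - 2) = 16 * d ^ 2 * (1 / (ρ - 2)) := by ring
  have e3 : 16 * (d : ℝ) ^ 2 / ρ = 16 * d ^ 2 * (1 / ρ) := by ring
  rw [e1, e2, e3]
  linarith

/-- The left side exceeds `1 - 2 / ρ`, the exact rate at which `ρ` shrinks, by at most `2 / (θ ρ) +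
2 d ^ 2 / ρ ^ 2`, which the exponential absorbs. -/
theorem weight_factor_le {d : ℕ} (hd : 1 ≤ d) {θ ρ : ℝ} (hθ : 1 ≤ θ)
    (hρ : 2 * (d : ℝ) ^ 2 ≤ ρ - 2) :
    1 - 2 / ρ * (1 - d ^ 2 / ρ) * (1 - 1 / θ) ≤
      (ρ - 2) / ρ * Real.exp (growth d θ (ρ - 2) - growth d θ ρ) := by
  have h2 := pos_of_two_mul_sq_le hd hρ
  have hρ0 : 0 < ρ := by linarith
  have h3 := growth_step hd hθ hρ
  have h4 := Real.add_one_le_exp (growth d θ (ρ - 2) - growth d θ ρ)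
  set x := 1 / θ
  have hx : 0 ≤ x := by positivity
  have e : (ρ - 2) / ρ = 1 - 2 / ρ := by field_simp
  have e' : (d : ℝ) ^ 2 / ρ ^ 2 = d ^ 2 / ρ * (1 / ρ) := by field_simp
  have hy : 2 / ρ ≤ 1 / 2 := by rw [div_le_div_iff₀ hρ0 (by norm_num)]; linarith
  have hz : 0 ≤ (d : ℝ) ^ 2 / ρ := by positivity
  have hw : 0 ≤ (1 : ℝ) / ρ := by positivity
  have h5 : (1 - 2 / ρ) * (1 + 4 * (4 / ρ * x + 8 * d ^ 2 / ρ ^ 2)) ≤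
      (1 - 2 / ρ) * Real.exp (growth d θ (ρ - 2) - growth d θ ρ) :=
    mul_le_mul_of_nonneg_left (by linarith) (by linarith)
  rw [e]
  refine le_trans ?_ h5
  have e1 : 2 / ρ = 2 * (1 / ρ) := by ring
  have e2 : 4 / ρ = 4 * (1 / ρ) := by ring
  have e3 : 8 * (d : ℝ) ^ 2 / ρ ^ 2 = 8 * (d ^ 2 / ρ * (1 / ρ)) := by rw [← e']; ring
  rw [e1] at hy
  rw [e1, e2, e3]
  set w := 1 / ρ
  set z := (d : ℝ) ^ 2 / ρ
  have p1 := mul_nonneg hw hx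
  have p2 := mul_nonneg hz hw
  have p3 := mul_nonneg p2 hx
  nlinarith [mul_le_mul_of_nonneg_right hy p1, mul_le_mul_of_nonneg_right hy p2]

theorem pairWeight_factor_le {d : ℕ} (hd : 1 ≤ d) {θ ρ : ℝ} (hθ : 1 ≤ θ)
    (hρ : 2 * (d : ℝ) ^ 2 ≤ ρ - 2) :
    1 - 4 / ρ * (1 - d ^ 2 / ρ) * (1 - 1 / θ) + 4 * d ^ 2 / ρ ^ 2 ≤
      ((ρ - 2) / ρ) ^ 2 * Real.exp (growth d θ (ρ - 2) - growth d θ ρ) := by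
  have h2 := pos_of_two_mul_sq_le hd hρ
  have hρ0 : 0 < ρ := by linarith
  have h3 := growth_step hd hθ hρ
  have h4 := Real.add_one_le_exp (growth d θ (ρ - 2) - growth d θ ρ)
  set x := 1 / θ
  have hx : 0 ≤ x := by positivity
  have e : (ρ - 2) / ρ = 1 - 2 / ρ := by field_simp
  have e' : (d : ℝ) ^ 2 / ρ ^ 2 = d ^ 2 / ρ * (1 / ρ) := by field_simp
  have hy : 2 / ρ ≤ 1 / 2 := by rw [div_le_div_iff₀ hρ0 (by norm_num)]; linarith
  have hz : 0 ≤ (d : ℝ) ^ 2 / ρ := by positivity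
  have hw : 0 ≤ (1 : ℝ) / ρ := by positivity
  have h5 : (1 - 2 / ρ) ^ 2 * (1 + 4 * (4 / ρ * x + 8 * d ^ 2 / ρ ^ 2)) ≤
      (1 - 2 / ρ) ^ 2 * Real.exp (growth d θ (ρ - 2) - growth d θ ρ) :=
    mul_le_mul_of_nonneg_left (by linarith) (by positivity)
  rw [e]
  refine le_trans ?_ h5
  have e1 : 2 / ρ = 2 * (1 / ρ) := by ring
  have e2 : 4 / ρ = 4 * (1 / ρ) := by ring
  have e3 : 8 * (d : ℝ) ^ 2 / ρ ^ 2 = 8 * (d ^ 2 / ρ * (1 / ρ)) := by rw [← e']; ring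
  have e4 : 4 * (d : ℝ) ^ 2 / ρ ^ 2 = 4 * (d ^ 2 / ρ * (1 / ρ)) := by rw [← e']; ring
  rw [e1] at hy
  rw [e1, e2, e3, e4]
  set w := 1 / ρ
  set z := (d : ℝ) ^ 2 / ρ
  have p1 := mul_nonneg hw hx
  have p2 := mul_nonneg hz hw
  have p3 := mul_nonneg p2 hx
  have hq : 1 / 4 ≤ (1 - 2 * w) ^ 2 := by nlinarith
  have hq' : 1 - 4 * w ≤ (1 - 2 * w) ^ 2 := by nlinarith
  have p4 : 0 ≤ 4 * (4 * w * x + 8 * (z * w)) := by nlinarith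
  nlinarith [mul_le_mul_of_nonneg_right hq p4]

/-- A discrete Grönwall inequality: the exponents telescope. -/
theorem le_of_succ_le_exp {u g : ℕ → ℝ} {s₀ s₁ : ℕ} (h01 : s₀ ≤ s₁)
    (h : ∀ s, s₀ ≤ s → s < s₁ → u (s + 1) ≤ Real.exp (g (s + 1) - g s) * u s) :
    u s₁ ≤ Real.exp (g s₁ - g s₀) * u s₀ := by
  induction s₁, h01 using Nat.le_induction with
  | base => simp
  | succ s hs ih =>
    have h1 := ih fun t ht ht' => h t ht (by omega)
    refine (h s hs (by omega)).trans ?_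
    have h2 := mul_le_mul_of_nonneg_left h1 (Real.exp_pos (g (s + 1) - g s)).le
    refine h2.trans (le_of_eq ?_)
    rw [← mul_assoc, ← Real.exp_add]
    congr 2
    ring

variable {s₀ s₁ : ℕ}

theorem deficit_mono (h : s₀ ≤ s₁) : deficit V d s₁ ≤ deficit V d s₀ := by
  unfold deficit
  have : (s₀ : ℝ) ≤ s₁ := by exact_mod_cast h
  linarith

/-- The expected weight per missing degree is nearly nonincreasing. With `geom θ j` this gives the
upper bound on the number of vertices of degree `j`. -/
theorem expAt_weight_le (ha : Geometric d θ a) (hθ : 1 ≤ θ) (hd : 1 ≤ d) (h01 : s₀ ≤ s₁)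
    (hs : 2 * (d : ℝ) ^ 2 ≤ deficit V d s₁) :
    expAt d s₁ (fun (G : SimpleGraph V) _ => weight a G) / deficit V d s₁ ≤
      Real.exp (growth d θ (deficit V d s₁) - growth d θ (deficit V d s₀)) *
        (expAt d s₀ (fun (G : SimpleGraph V) _ => weight a G) / deficit V d s₀) := by
  refine le_of_succ_le_exp (u := fun s : ℕ => expAt d s (fun (G : SimpleGraph V) _ => weight a G) /
    deficit V d s) (g := fun s => growth d θ (deficit V d s)) h01 fun s hs0 hs1 => ?_
  have h1 : 2 * (d : ℝ) ^ 2 ≤ deficit V d s - 2 := by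
    rw [← deficit_succ (V := V)]
    exact hs.trans (deficit_mono (by omega))
  have h2 := pos_of_two_mul_sq_le hd h1
  simp only [deficit_succ (V := V)]
  set ρ := deficit V d s with hρ
  rw [div_le_iff₀ (by linarith), expAt_succ]
  have h3 : expAt d s (clockStep d fun (G : SimpleGraph V) _ => weight a G) ≤
      expAt d s (fun (G : SimpleGraph V) _ => ((ρ - 2) / ρ * Real.exp (growth d θ (ρ - 2) - growth d θ ρ)) *
        weight a G) := by
    refine expAt_mono fun G X hR => ?_
    refine (stepExp_weight_le ha hθ hR hd (by rw [← hρ]; linarith)).trans ?_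
    rw [← hρ]
    exact mul_le_mul_of_nonneg_right (weight_factor_le hd hθ h1) (weight_nonneg ha.nonneg G)
  rw [expAt_const_mul] at h3
  refine h3.trans (le_of_eq ?_)
  ring

theorem expAt_pairWeight_le (ha : Geometric d θ a) (hb : Geometric d θ b) (hθ : 1 ≤ θ)
    (hd : 1 ≤ d) (h01 : s₀ ≤ s₁) (hs : 2 * (d : ℝ) ^ 2 ≤ deficit V d s₁) :
    expAt d s₁ (fun (G : SimpleGraph V) _ => pairWeight a b G) / deficit V d s₁ ^ 2 ≤
      Real.exp (growth d θ (deficit V d s₁) - growth d θ (deficit V d s₀)) *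
        (expAt d s₀ (fun (G : SimpleGraph V) _ => pairWeight a b G) / deficit V d s₀ ^ 2) := by
  refine le_of_succ_le_exp (u := fun s : ℕ => expAt d s (fun (G : SimpleGraph V) _ => pairWeight a b G) /
    deficit V d s ^ 2) (g := fun s => growth d θ (deficit V d s)) h01 fun s hs0 hs1 => ?_
  have h1 : 2 * (d : ℝ) ^ 2 ≤ deficit V d s - 2 := by
    rw [← deficit_succ (V := V)]
    exact hs.trans (deficit_mono (by omega))
  have h2 := pos_of_two_mul_sq_le hd h1
  simp only [deficit_succ (V := V)]
  set ρ := deficit V d s with hρ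
  rw [div_le_iff₀ (by nlinarith), expAt_succ]
  have h3 : expAt d s (clockStep d fun (G : SimpleGraph V) _ => pairWeight a b G) ≤
      expAt d s (fun (G : SimpleGraph V) _ => (((ρ - 2) / ρ) ^ 2 * Real.exp (growth d θ (ρ - 2) - growth d θ ρ)) *
        pairWeight a b G) := by
    refine expAt_mono fun G X hR => ?_
    refine (stepExp_pairWeight_le ha hb hθ hR hd (by rw [← hρ]; linarith)).trans ?_
    rw [← hρ]
    exact mul_le_mul_of_nonneg_right (pairWeight_factor_le hd hθ h1)
      (pairWeight_nonneg ha.nonneg hb.nonneg G)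
  rw [expAt_const_mul] at h3
  refine h3.trans (le_of_eq ?_)
  ring

/-- The weight `θ ^ (j - i)` of the degrees `i ≤ j`. -/
def geom (θ : ℝ) (j i : ℕ) : ℝ := if i ≤ j then θ ^ (j - i) else 0

theorem geom_geometric {j : ℕ} (hj : j < d) (hθ : 1 ≤ θ) : Geometric d θ (geom θ j) where
  nonneg i := by unfold geom; split_ifs <;> positivity
  shrink i := by
    unfold geom
    by_cases h : i + 1 ≤ j
    · rw [if_pos h, if_pos (by omega), show j - i = (j - (i + 1)) + 1 by omega, pow_succ]
      rw [mul_div_cancel_right₀ _ (by linarith)]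
    · rw [if_neg h]
      split_ifs <;> positivity
  zero i hi := by unfold geom; rw [if_neg (by omega)]

/-- The indicator of the degree `j`. -/
def isDeg (j i : ℕ) : ℝ := if i = j then 1 else 0

/-- The indicator of the degrees up to `j`. -/
def isLow (j i : ℕ) : ℝ := if i ≤ j then 1 else 0

theorem isDeg_nonneg (j i : ℕ) : 0 ≤ isDeg j i := by unfold isDeg; split_ifs <;> norm_num

theorem isLow_nonneg (j i : ℕ) : 0 ≤ isLow j i := by unfold isLow; split_ifs <;> norm_num

theorem isDeg_le_geom (hθ : 1 ≤ θ) (j i : ℕ) : isDeg j i ≤ geom θ j i := by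
  unfold isDeg geom
  split_ifs with h1 h2
  · exact one_le_pow₀ hθ
  · omega
  · positivity
  · rfl

theorem isLow_le_geom (hθ : 1 ≤ θ) (j i : ℕ) : isLow j i ≤ geom θ j i := by
  unfold isLow geom
  split_ifs with h1
  · exact one_le_pow₀ hθ
  · rfl

theorem degCount_eq_weight (j : ℕ) (G : SimpleGraph V) : degCount j G = weight (isDeg j) G := by
  classical
  unfold degCount weight isDeg
  refine sum_congr rfl fun v _ => ?_
  by_cases h : deg G v = j <;> simp [h]

theorem degCount_nonneg (j : ℕ) (G : SimpleGraph V) : 0 ≤ degCount j G := by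
  rw [degCount_eq_weight]; exact weight_nonneg (isDeg_nonneg j) G

/-- A vertex of degree `d - 1` counts once in both quantities, so only degrees up to `d - 2`
contribute to the difference. -/
theorem Reach.deficit_sub_free_le (h : Reach d s G X) (hd : 2 ≤ d)
    (hs : 2 * (d : ℝ) ^ 2 ≤ deficit V d s) :
    deficit V d s - free d G ≤ d * weight (isLow (d - 2)) G := by
  rw [← h.sum_missing (by omega) hs, sum_missing_eq h.deg_le, free, card_eq_sum_ones, Nat.cast_sum,
    ← sum_sub_distrib, weight, mul_sum]
  have : ∑ v ∈ unsat d G, (d : ℝ) * isLow (d - 2) (deg G v) ≤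
      ∑ v, (d : ℝ) * isLow (d - 2) (deg G v) :=
    sum_le_sum_of_subset_of_nonneg (subset_univ _)
      fun v _ _ => mul_nonneg (by positivity) (isLow_nonneg _ _)
  refine le_trans (sum_le_sum fun v hv => ?_) this
  have hv' := mem_unsat.1 hv
  unfold isLow
  split_ifs with h1
  · simp; linarith
  · have : deg G v = d - 1 := by omega
    rw [this, Nat.cast_sub (by omega)]
    simp

theorem Reach.hitProb_le (h : Reach d s G X) (hd : 2 ≤ d)
    (hs : 2 * (d : ℝ) ^ 2 ≤ deficit V d s) (v : V) :
    hitProb d G v ≤ 2 / deficit V d s + 2 * d ^ 2 / deficit V d s ^ 2 * weight (isLow (d - 2)) G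
      + 4 * d ^ 3 / deficit V d s ^ 2 := by
  have hd1 : 1 ≤ d := by omega
  have hd' : (1 : ℝ) ≤ d := by exact_mod_cast hd1
  have hρ := pos_of_two_mul_sq_le hd1 hs
  have hw := weight_nonneg (isLow_nonneg (d - 2)) G
  by_cases hv : v ∈ unsat d G
  swap
  · rw [hitProb_eq_zero hv]; positivity
  have hU := h.le_free hd1 hs
  refine (hitProb_bounds hd1 hU hv).2.trans ?_
  have h1 := h.one_div_free_le hd1 hs
  have h2 := h.deficit_sub_free_le hd hs
  set U := free d G
  set ρ := deficit V d s
  set w := weight (isLow (d - 2)) G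
  have hU0 : 0 < U := by linarith
  have hρ0 : 0 < ρ := by linarith
  -- Trading `U` for `ρ` in the main term costs `ρ - U`, hence low-degree vertices only.
  have e : 2 / U * (1 + 2 * d / U) = 2 / ρ + 2 / ρ * (1 / U) * (ρ - U) + 4 * d * (1 / U) ^ 2 := by
    field_simp; ring
  rw [e]
  have a1 : 2 / ρ * (1 / U) * (ρ - U) ≤ 2 / ρ * (1 / U) * (d * w) :=
    mul_le_mul_of_nonneg_left h2 (by positivity)
  have a2 : 2 / ρ * (1 / U) * (d * w) ≤ 2 / ρ * (d / ρ) * (d * w) := by gcongr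
  have a3 : 4 * d * (1 / U) ^ 2 ≤ 4 * d * (d / ρ) ^ 2 := by gcongr
  have e2 : 2 / ρ * (d / ρ) * (d * w) = 2 * d ^ 2 / ρ ^ 2 * w := by field_simp
  have e3 : 4 * d * (d / ρ) ^ 2 = 4 * d ^ 3 / ρ ^ 2 := by field_simp
  linarith

/-- Inflow from degree `j - 1` is dropped. The loss contains the product of `degCount j G` and the
number of low-degree vertices; its off-diagonal part is a pair weight and its diagonal is at most
`degCount j G`. -/
theorem stepExp_degCount_ge {j : ℕ} (h : Reach d s G X) (hd : 2 ≤ d)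
    (hs : 2 * (d : ℝ) ^ 2 ≤ deficit V d s) :
    (1 - 2 / deficit V d s) * degCount j G
      - 2 * d ^ 2 / deficit V d s ^ 2 * pairWeight (isDeg j) (isLow (d - 2)) G
      - 6 * d ^ 3 / deficit V d s ^ 2 * degCount j G ≤ stepExp d G (degCount j) := by
  have hd1 : 1 ≤ d := by omega
  have hd' : (1 : ℝ) ≤ d := by exact_mod_cast hd1
  have hρ := pos_of_two_mul_sq_le hd1 hs
  have hA := available_nonempty hd1 (h.le_free hd1 hs)
  have e : (degCount j : SimpleGraph V → ℝ) = fun H => ∑ v, isDeg j (deg H v) := by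
    funext H; exact degCount_eq_weight j H
  have h0 := stepExp_sum_deg hA (isDeg j)
  rw [← e] at h0
  rw [h0]
  set ρ := deficit V d s
  set w := weight (isLow (d - 2)) G with hw
  have h1 : degCount j G * (1 - (2 / ρ + 2 * d ^ 2 / ρ ^ 2 * w + 4 * d ^ 3 / ρ ^ 2)) ≤
      ∑ v, (isDeg j (deg G v) +
        hitProb d G v * (isDeg j (deg G v + 1) - isDeg j (deg G v))) := by
    rw [degCount_eq_weight, weight, sum_mul]
    refine sum_le_sum fun v _ => ?_
    have a1 := mul_le_mul_of_nonneg_left (h.hitProb_le hd hs v) (isDeg_nonneg j (deg G v))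
    have a2 := mul_nonneg (hitProb_nonneg d G v) (isDeg_nonneg j (deg G v + 1))
    linarith
  have h2 : degCount j G * w ≤ pairWeight (isDeg j) (isLow (d - 2)) G + degCount j G := by
    rw [hw, degCount_eq_weight, weight_mul_weight]
    gcongr
    refine sum_le_sum fun v _ => ?_
    unfold isDeg isLow
    split_ifs <;> simp
  have h3 := mul_le_mul_of_nonneg_left h2 (show 0 ≤ 2 * (d : ℝ) ^ 2 / ρ ^ 2 by positivity)
  have h4 : 2 * (d : ℝ) ^ 2 / ρ ^ 2 * degCount j G ≤ 2 * d ^ 3 / ρ ^ 2 * degCount j G := by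
    have := degCount_nonneg j G
    gcongr ?_ / _ * _
    nlinarith [sq_nonneg (d : ℝ)]
  have e6 : 6 * (d : ℝ) ^ 3 / ρ ^ 2 = 2 * d ^ 3 / ρ ^ 2 + 4 * d ^ 3 / ρ ^ 2 := by ring
  rw [e6]
  linarith

/-- Dividing the one-step bound by the new deficit `ρ - 2` leaves losses of order `P / (ρ - 2)` and
`Y / (ρ (ρ - 2))`. The first sums to a logarithm, the second telescopes exactly. -/
theorem expAt_degCount_ge {j : ℕ} {P Y : ℝ} (hd : 2 ≤ d) (h01 : s₀ ≤ s₁)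
    (hs : 2 * (d : ℝ) ^ 2 ≤ deficit V d s₁)
    (hP : ∀ s, s₀ ≤ s → s < s₁ →
      expAt d s (fun (G : SimpleGraph V) _ => pairWeight (isDeg j) (isLow (d - 2)) G) /
        deficit V d s ^ 2 ≤ P)
    (hY : ∀ s, s₀ ≤ s → s < s₁ →
      expAt d s (fun (G : SimpleGraph V) _ => degCount j G) / deficit V d s ≤ Y) :
    expAt d s₀ (fun (G : SimpleGraph V) _ => degCount j G) / deficit V d s₀
      - 2 * d ^ 2 * P * (Real.log (deficit V d s₀) - Real.log (deficit V d s₁))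
      - 3 * d ^ 3 * Y * (1 / deficit V d s₁ - 1 / deficit V d s₀) ≤
    expAt d s₁ (fun (G : SimpleGraph V) _ => degCount j G) / deficit V d s₁ := by
  induction s₁, h01 using Nat.le_induction with
  | base => simp
  | succ s hs0 ih =>
    rw [deficit_succ (V := V)] at hs ⊢
    have ih' := ih (by linarith) (fun t h1 h2 => hP t h1 (by omega))
      (fun t h1 h2 => hY t h1 (by omega))
    have hP' := hP s hs0 (by omega)
    have hY' := hY s hs0 (by omega)
    have h2 := pos_of_two_mul_sq_le (by omega) hs
    have hstep : expAt d s (fun (G : SimpleGraph V) _ => degCount j G) *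
          (1 - 2 / deficit V d s - 6 * d ^ 3 / deficit V d s ^ 2)
        - 2 * d ^ 2 / deficit V d s ^ 2 *
          expAt d s (fun (G : SimpleGraph V) _ => pairWeight (isDeg j) (isLow (d - 2)) G) ≤
        expAt d (s + 1) (fun (G : SimpleGraph V) _ => degCount j G) := by
      rw [expAt_succ, mul_comm, sub_eq_add_neg, ← neg_mul, ← expAt_const_mul, ← expAt_const_mul,
        ← expAt_add]
      refine expAt_mono fun G X hR => ?_
      have := stepExp_degCount_ge (j := j) hR hd (by linarith)
      change _ ≤ stepExp d G (degCount j)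
      linarith
    set ρ := deficit V d s
    set y := expAt d s (fun (G : SimpleGraph V) _ => degCount j G)
    set p := expAt d s (fun (G : SimpleGraph V) _ => pairWeight (isDeg j) (isLow (d - 2)) G)
    have hp : 0 < ρ - 2 := by linarith
    have hρ0 : 0 < ρ := by linarith
    have hP0 : 0 ≤ P := le_trans (div_nonneg (expAt_nonneg fun G _ =>
      pairWeight_nonneg (isDeg_nonneg _) (isLow_nonneg _) G) (by positivity)) hP'
    have l1 := Real.log_le_sub_one_of_pos (show 0 < (ρ - 2) / ρ by positivity)
    have l2 : (ρ - 2) / ρ - 1 = -(2 / ρ) := by field_simp; ring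
    rw [l2, Real.log_div hp.ne' hρ0.ne'] at l1
    have l3 : 1 / (ρ - 2) ≤ 2 / ρ := by
      rw [div_le_div_iff₀ hp hρ0]; linarith
    have h4 : (1 - 2 / ρ - 6 * d ^ 3 / ρ ^ 2) * y - 2 * d ^ 2 / ρ ^ 2 * p =
        (ρ - 2) * (y / ρ) - 6 * d ^ 3 / ρ * (y / ρ) - 2 * d ^ 2 * (p / ρ ^ 2) := by
      field_simp
    have h5 : 6 * (d : ℝ) ^ 3 / ρ * (y / ρ) ≤ 6 * d ^ 3 / ρ * Y := by gcongr
    have h6 : 2 * (d : ℝ) ^ 2 * (p / ρ ^ 2) ≤ 2 * d ^ 2 * P := by gcongr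
    have h7 : y / ρ - 6 * d ^ 3 * Y * (1 / (ρ * (ρ - 2))) - 2 * d ^ 2 * P * (1 / (ρ - 2)) ≤
        expAt d (s + 1) (fun (G : SimpleGraph V) _ => degCount j G) / (ρ - 2) := by
      rw [le_div_iff₀ hp]
      have : (y / ρ - 6 * d ^ 3 * Y * (1 / (ρ * (ρ - 2))) - 2 * d ^ 2 * P * (1 / (ρ - 2))) *
          (ρ - 2) = (ρ - 2) * (y / ρ) - 6 * d ^ 3 / ρ * Y - 2 * d ^ 2 * P := by
        field_simp
      rw [this]
      linarith
    have h8 : 2 * d ^ 2 * P * (1 / (ρ - 2)) ≤ 2 * d ^ 2 * P * (Real.log ρ - Real.log (ρ - 2)) :=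
      mul_le_mul_of_nonneg_left (by linarith) (by positivity)
    have h9 : 6 * (d : ℝ) ^ 3 * Y * (1 / (ρ * (ρ - 2))) =
        3 * d ^ 3 * Y * (1 / (ρ - 2) - 1 / ρ) := by
      field_simp; ring
    rw [h9] at h7
    linarith

end Weights

end RandomDGraph

end

/-! ### First phase: approximate martingales and their second moments. -/

noncomputable section

namespace RandomDGraph

open Finset
open scoped Nat

section Martingales

/-- The functions `e ^ x (-x) ^ (k - i) / (k - i)!`, which solve the backward equations of the
process run by its clock. -/
def charlier (k : ℕ) (x : ℝ) (i : ℕ) : ℝ :=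
  if i ≤ k then Real.exp x * ((-x) ^ (k - i) / (k - i)!) else 0

/-- This is the backward equation of a counter jumping from `i` to `i + 1` at unit rate: the drift
in time cancels the expected jump `charlier k x (i + 1) - charlier k x i`. -/
theorem hasDerivAt_charlier (k i : ℕ) (x : ℝ) :
    HasDerivAt (fun y => charlier k y i) (charlier k x i - charlier k x (i + 1)) x := by
  unfold charlier
  rcases lt_trichotomy i k with h | rfl | h
  · obtain ⟨m, rfl⟩ : ∃ m, k = i + (m + 1) := ⟨k - i - 1, by omega⟩
    simp only [show i ≤ i + (m + 1) by omega, show i + 1 ≤ i + (m + 1) by omega, if_true,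
      show i + (m + 1) - i = m + 1 by omega, show i + (m + 1) - (i + 1) = m by omega]
    have h1 : HasDerivAt (fun y : ℝ => (-y) ^ (m + 1) / ((m + 1)! : ℝ))
        (((m + 1 : ℕ) : ℝ) * (-x) ^ m * (-1) / ((m + 1)! : ℝ)) x := by
      simpa using ((hasDerivAt_neg x).pow (m + 1)).div_const ((m + 1)! : ℝ)
    have h2 := (Real.hasDerivAt_exp x).mul h1
    refine h2.congr_deriv ?_
    rw [Nat.factorial_succ]
    push_cast
    field_simp
    ring
  · simpa using Real.hasDerivAt_exp x
  · simp only [show ¬ i ≤ k by omega, show ¬ i + 1 ≤ k by omega, if_false, sub_zero]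
    exact hasDerivAt_const x 0

theorem abs_charlier_le {d k : ℕ} (hk : k < d) {x B : ℝ} (hx : 0 ≤ x) (hxB : x ≤ B) (hB : 1 ≤ B)
    (i : ℕ) : |charlier k x i| ≤ Real.exp x * B ^ d := by
  unfold charlier
  split_ifs with h
  · rw [abs_mul, abs_of_pos (Real.exp_pos x), abs_div, abs_pow, abs_neg, abs_of_nonneg hx,
      Nat.abs_cast]
    gcongr
    calc x ^ (k - i) / ((k - i)! : ℝ) ≤ x ^ (k - i) :=
          div_le_self (by positivity) (by exact_mod_cast Nat.one_le_iff_ne_zero.2 (Nat.factorial_ne_zero _))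
      _ ≤ B ^ (k - i) := by gcongr
      _ ≤ B ^ d := pow_le_pow_right₀ hB (by omega)
  · simp; positivity

theorem charlier_eq_zero {k i : ℕ} (h : k < i) (x : ℝ) : charlier k x i = 0 := by
  unfold charlier; rw [if_neg (by omega)]

theorem sum_pow_div_factorial (x y : ℝ) (N : ℕ) :
    ∑ m ∈ range (N + 1), x ^ (N - m) / (N - m)! * (y ^ m / m !) = (x + y) ^ N / N ! := by
  rw [add_comm x y, add_pow, sum_div]
  refine sum_congr rfl fun m hm => ?_
  have hm' : m ≤ N := by simpa [Nat.lt_succ_iff] using hm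
  have := Nat.choose_mul_factorial_mul_factorial hm'
  have h : (N.choose m : ℝ) * m ! * (N - m)! = N ! := by exact_mod_cast this
  rw [← h]
  have h0 : (N.choose m : ℝ) ≠ 0 := by exact_mod_cast (Nat.choose_pos hm').ne'
  field_simp

/-- Inverts the triangular system, so that degree counts can be recovered from the martingales. The
sum is the binomial expansion of `(x + (-x)) ^ (i - l)`, which vanishes unless `l = i`. -/
theorem sum_charlier (i l : ℕ) (x : ℝ) :
    ∑ k ∈ range (i + 1), x ^ (i - k) / (i - k)! * charlier k x l = Real.exp x * isDeg i l := by
  by_cases hl : l ≤ i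
  · have h1 : ∑ k ∈ range (i + 1), x ^ (i - k) / (i - k)! * charlier k x l =
        ∑ k ∈ Ico l (i + 1), x ^ (i - k) / (i - k)! * charlier k x l := by
      symm
      refine sum_subset (fun k hk => by simp at hk ⊢; omega) fun k hk hk' => ?_
      rw [charlier_eq_zero (by simp at hk hk'; omega), mul_zero]
    rw [h1, sum_Ico_eq_sum_range]
    have h2 := sum_pow_div_factorial x (-x) (i - l)
    have h3 : (x + -x) ^ (i - l) / ((i - l)! : ℝ) = isDeg i l := by
      unfold isDeg
      split_ifs with h
      · subst h; simp
      · rw [add_neg_cancel, zero_pow (by omega), zero_div]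
    rw [h3] at h2
    rw [← h2, mul_sum, show i + 1 - l = i - l + 1 by omega]
    refine sum_congr rfl fun m hm => ?_
    unfold charlier
    rw [if_pos (by omega), show l + m - l = m by omega, show i - (l + m) = i - l - m by omega]
    ring
  · have : isDeg i l = 0 := by unfold isDeg; rw [if_neg (by omega)]
    rw [this, mul_zero]
    refine sum_eq_zero fun k hk => ?_
    rw [charlier_eq_zero (by simp at hk; omega), mul_zero]

theorem abs_charlier_sub_le {d k : ℕ} (hk : k < d) {x h B : ℝ} (hx : 0 ≤ x) (hh : 0 ≤ h)
    (hxB : x + h ≤ B) (hB : 1 ≤ B) (i : ℕ) :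
    |charlier k (x + h) i - charlier k x i| ≤ 2 * (Real.exp (x + h) * B ^ d) * h := by
  have key := (convex_Icc x (x + h)).norm_image_sub_le_of_norm_hasDerivWithin_le
    (f := fun y => charlier k y i) (f' := fun y => charlier k y i - charlier k y (i + 1))
    (C := 2 * (Real.exp (x + h) * B ^ d)) (x := x) (y := x + h)
    (fun y _ => (hasDerivAt_charlier k i y).hasDerivWithinAt) ?_
    (by simp [hh]) (by simp [hh])
  · simpa [abs_of_nonneg hh] using key
  · intro y hy
    have hy0 : 0 ≤ y := hx.trans hy.1
    have hyB : y ≤ B := hy.2.trans hxB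
    have e : Real.exp y * B ^ d ≤ Real.exp (x + h) * B ^ d := by
      gcongr; exact hy.2
    have a1 := abs_charlier_le hk hy0 hyB hB i
    have a2 := abs_charlier_le hk hy0 hyB hB (i + 1)
    rw [Real.norm_eq_abs]
    linarith [abs_sub (charlier k y i) (charlier k y (i + 1))]

/-- The expansion is about the right end point, because the expected jump in a step is evaluated at
the advanced clock `x + h`. -/
theorem abs_charlier_taylor_le {d k : ℕ} (hk : k < d) {x h B : ℝ} (hx : 0 ≤ x) (hh : 0 ≤ h)
    (hxB : x + h ≤ B) (hB : 1 ≤ B) (i : ℕ) :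
    |charlier k (x + h) i - charlier k x i
      - h * (charlier k (x + h) i - charlier k (x + h) (i + 1))| ≤
      4 * (Real.exp (x + h) * B ^ d) * h ^ 2 := by
  set c := charlier k (x + h) i - charlier k (x + h) (i + 1) with hc
  have key := (convex_Icc x (x + h)).norm_image_sub_le_of_norm_hasDerivWithin_le
    (f := fun y => charlier k y i - y * c)
    (f' := fun y => charlier k y i - charlier k y (i + 1) - c)
    (C := 4 * (Real.exp (x + h) * B ^ d) * h) (x := x) (y := x + h)
    (fun y _ => ((hasDerivAt_charlier k i y).sub
      (by simpa using (hasDerivAt_id y).mul_const c)).hasDerivWithinAt) ?_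
    (by simp [hh]) (by simp [hh])
  · rw [Real.norm_eq_abs, Real.norm_eq_abs, add_sub_cancel_left, abs_of_nonneg hh] at key
    refine le_trans (le_of_eq ?_) (key.trans (le_of_eq ?_))
    · congr 1; ring
    · ring
  · intro y hy
    have hy0 : 0 ≤ y := hx.trans hy.1
    have b1 := abs_charlier_sub_le hk hy0 (h := x + h - y) (by linarith [hy.2]) (B := B)
      (by linarith) hB i
    have b2 := abs_charlier_sub_le hk hy0 (h := x + h - y) (by linarith [hy.2]) (B := B)
      (by linarith) hB (i + 1)
    rw [show y + (x + h - y) = x + h by ring] at b1 b2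
    have b3 : 2 * (Real.exp (x + h) * B ^ d) * (x + h - y) ≤
        2 * (Real.exp (x + h) * B ^ d) * h := by
      gcongr; linarith [hy.1]
    rw [Real.norm_eq_abs, hc]
    have e : charlier k y i - charlier k y (i + 1) -
        (charlier k (x + h) i - charlier k (x + h) (i + 1)) =
        (charlier k (x + h) (i + 1) - charlier k y (i + 1)) -
          (charlier k (x + h) i - charlier k y i) := by ring
    rw [e]
    linarith [abs_sub (charlier k (x + h) (i + 1) - charlier k y (i + 1))
      (charlier k (x + h) i - charlier k y i)]

variable {V : Type*} [Fintype V]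

/-- The value of the `k`-th martingale in the fluid limit. -/
def startVal (V : Type*) [Fintype V] (k : ℕ) : ℝ := if k = 0 then Fintype.card V else 0

/-- The sum of the squared deviations of the martingales. -/
def deviation (d : ℕ) (G : SimpleGraph V) (X : ℝ) : ℝ :=
  ∑ k ∈ range d, (weight (charlier k X) G - startVal V k) ^ 2

theorem deviation_nonneg (d : ℕ) (G : SimpleGraph V) (X : ℝ) : 0 ≤ deviation d G X :=
  sum_nonneg fun _ _ => sq_nonneg _

theorem deviation_start (d : ℕ) : deviation d (⊥ : SimpleGraph V) 0 = 0 := by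
  refine sum_eq_zero fun k _ => ?_
  simp only [weight, deg_bot, charlier, startVal]
  rcases Nat.eq_zero_or_pos k with rfl | hk
  · simp
  · simp [hk.ne']

/-- The Poisson profile is what the inversion formula returns when each martingale has its starting
value, and only the one with `k = 0` starts away from zero. -/
theorem exp_mul_degCount_sub (i : ℕ) (G : SimpleGraph V) (X : ℝ) :
    Real.exp X * degCount i G - Fintype.card V * (X ^ i / i !) =
      ∑ k ∈ range (i + 1), X ^ (i - k) / (i - k)! * (weight (charlier k X) G - startVal V k) := by
  simp_rw [mul_sub, sum_sub_distrib]
  congr 1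
  · rw [degCount_eq_weight]
    unfold weight
    simp_rw [mul_sum, ← sum_charlier]
    rw [sum_comm]
  · rw [sum_eq_single 0]
    · simp [startVal, mul_comm]
    · intro k _ hk
      simp [startVal, hk]
    · simp

theorem abs_exp_mul_degCount_sub_le {d i : ℕ} (hi : i < d) (G : SimpleGraph V) {X B : ℝ}
    (hX : 0 ≤ X) (hXB : X ≤ B) (hB : 1 ≤ B) :
    |Real.exp X * degCount i G - Fintype.card V * (X ^ i / i !)| ≤
      B ^ d * ∑ k ∈ range d, |weight (charlier k X) G - startVal V k| := by
  rw [exp_mul_degCount_sub, mul_sum]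
  refine (abs_sum_le_sum_abs _ _).trans ?_
  refine (sum_le_sum fun k hk => ?_).trans
    (sum_le_sum_of_subset_of_nonneg (s := range (i + 1)) (range_subset_range.2 hi)
      fun k _ _ => by positivity)
  rw [abs_mul]
  gcongr
  rw [abs_of_nonneg (by positivity)]
  calc X ^ (i - k) / ((i - k)! : ℝ) ≤ X ^ (i - k) :=
        div_le_self (by positivity) (by exact_mod_cast Nat.one_le_iff_ne_zero.2 (Nat.factorial_ne_zero _))
    _ ≤ B ^ (i - k) := by gcongr
    _ ≤ B ^ d := pow_le_pow_right₀ hB (by omega)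

theorem sq_sum_abs_le_deviation (d : ℕ) (G : SimpleGraph V) (X : ℝ) :
    (∑ k ∈ range d, |weight (charlier k X) G - startVal V k|) ^ 2 ≤ d * deviation d G X := by
  have := sq_sum_le_card_mul_sum_sq (s := range d)
    (f := fun k => |weight (charlier k X) G - startVal V k|)
  simpa [deviation] using this

theorem free_eq_sum_degCount (d : ℕ) (G : SimpleGraph V) :
    free d G = ∑ i ∈ range d, degCount i G := by
  classical
  simp_rw [degCount_eq_weight, weight]
  rw [sum_comm, free, unsat, card_filter, Nat.cast_sum]
  refine sum_congr rfl fun v _ => ?_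
  unfold isDeg
  rw [sum_ite_eq]
  simp

/-- Closes the second moment recursion: jumps of the martingales are of size `e ^ X` up to powers of
`B`, and this expresses `e ^ X` through `1 / U` and the deviation itself. -/
theorem sq_exp_mul_free_le (d : ℕ) (hd : 1 ≤ d) (G : SimpleGraph V) {X B : ℝ}
    (hX : 0 ≤ X) (hXB : X ≤ B) (hB : 1 ≤ B) :
    (Real.exp X * free d G) ^ 2 ≤
      2 * d ^ 3 * B ^ (2 * d) * (deviation d G X + (Fintype.card V : ℝ) ^ 2) := by
  set n := (Fintype.card V : ℝ)
  set S := ∑ k ∈ range d, |weight (charlier k X) G - startVal V k| with hS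
  have hd' : (1 : ℝ) ≤ d := by exact_mod_cast hd
  have hS0 : 0 ≤ S := sum_nonneg fun _ _ => abs_nonneg _
  have hn : 0 ≤ n := by positivity
  have h1 : Real.exp X * free d G ≤ d * (B ^ d * (n + S)) := by
    rw [free_eq_sum_degCount, mul_sum]
    have : ∀ i ∈ range d, Real.exp X * degCount i G ≤ B ^ d * (n + S) := by
      intro i hi
      have hi' := mem_range.1 hi
      have h1 := (abs_le.1 (abs_exp_mul_degCount_sub_le hi' G hX hXB hB)).2
      have h2 : X ^ i / (i ! : ℝ) ≤ B ^ d :=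
        calc X ^ i / (i ! : ℝ) ≤ X ^ i :=
            div_le_self (by positivity)
              (by exact_mod_cast Nat.one_le_iff_ne_zero.2 (Nat.factorial_ne_zero _))
          _ ≤ B ^ i := by gcongr
          _ ≤ B ^ d := pow_le_pow_right₀ hB (by omega)
      have h3 := mul_le_mul_of_nonneg_left h2 hn
      linarith
    have := sum_le_sum this
    simpa using this
  have h2 := sq_sum_abs_le_deviation d G X
  rw [← hS] at h2
  have h0 : 0 ≤ Real.exp X * free d G := mul_nonneg (Real.exp_pos X).le (free_nonneg d G)
  calc (Real.exp X * free d G) ^ 2 ≤ (d * (B ^ d * (n + S))) ^ 2 := by gcongr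
    _ = d ^ 2 * B ^ (2 * d) * (n + S) ^ 2 := by rw [pow_mul']; ring
    _ ≤ d ^ 2 * B ^ (2 * d) * (2 * (d * (deviation d G X + n ^ 2))) := by
        gcongr
        nlinarith [sq_nonneg (n - S), mul_nonneg (sub_nonneg.2 hd') (sq_nonneg n)]
    _ = _ := by ring

variable {d : ℕ} {G : SimpleGraph V} {X B : ℝ}

/-- After the cancellation by the backward equation, each of the `U` unsaturated vertices
contributes only a Taylor error and the error of `hitProb` against `2 / U`, both of order `1 / U ^
2`. -/
theorem abs_stepExp_weight_charlier_sub_le {k : ℕ} (hk : k < d) (hU : 2 * (d : ℝ) ≤ free d G)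
    (hX : 0 ≤ X) (hXB : X + 2 / free d G ≤ B) (hB : 1 ≤ B) :
    |stepExp d G (weight (charlier k (X + 2 / free d G))) - weight (charlier k X) G| ≤
      24 * d * (Real.exp (X + 2 / free d G) * B ^ d) / free d G := by
  have hd : 1 ≤ d := by omega
  have hd' : (1 : ℝ) ≤ d := by exact_mod_cast hd
  have hU0 : 0 < free d G := by linarith
  set h := 2 / free d G with hh
  have hh0 : 0 ≤ h := by positivity
  have e := stepExp_sum_deg (available_nonempty hd hU) (charlier k (X + h))
  change stepExp d G (weight (charlier k (X + h))) = _ at e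
  rw [e, weight, ← sum_sub_distrib]
  set S := Real.exp (X + h) * B ^ d with hS
  have hS0 : 0 ≤ S := by positivity
  refine (abs_sum_le_sum_abs _ _).trans ?_
  have : ∑ v, |charlier k (X + h) (deg G v) + hitProb d G v * (charlier k (X + h) (deg G v + 1)
      - charlier k (X + h) (deg G v)) - charlier k X (deg G v)| =
      ∑ v ∈ unsat d G, |charlier k (X + h) (deg G v) + hitProb d G v *
        (charlier k (X + h) (deg G v + 1) - charlier k (X + h) (deg G v))
        - charlier k X (deg G v)| := by
    symm
    refine sum_subset (subset_univ _) fun v _ hv => ?_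
    have hv' : d ≤ deg G v := by simpa [mem_unsat] using hv
    rw [charlier_eq_zero (by omega), charlier_eq_zero (by omega), charlier_eq_zero (by omega)]
    simp
  rw [this]
  have key : ∀ v ∈ unsat d G, |charlier k (X + h) (deg G v) + hitProb d G v *
        (charlier k (X + h) (deg G v + 1) - charlier k (X + h) (deg G v))
        - charlier k X (deg G v)| ≤ 24 * d * S / free d G ^ 2 := by
    intro v hv
    have t1 := abs_charlier_taylor_le hk hX hh0 hXB hB (deg G v)
    have t2 := abs_hitProb_sub_le hd hU hv
    rw [← hh] at t2
    rw [← hS] at t1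
    have a1 := abs_charlier_le hk (by linarith : 0 ≤ X + h) hXB hB (deg G v)
    have a2 := abs_charlier_le hk (by linarith : 0 ≤ X + h) hXB hB (deg G v + 1)
    set f := charlier k (X + h) (deg G v)
    set f' := charlier k (X + h) (deg G v + 1)
    have a3 : |f' - f| ≤ 2 * S := by linarith [abs_sub f' f]
    have e1 : f + hitProb d G v * (f' - f) - charlier k X (deg G v) =
        (f - charlier k X (deg G v) - h * (f - f')) + (hitProb d G v - h) * (f' - f) := by ring
    rw [e1]
    refine (abs_add_le _ _).trans ?_
    rw [abs_mul]
    have t3 : |hitProb d G v - h| * |f' - f| ≤ 4 * d / free d G ^ 2 * (2 * S) :=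
      mul_le_mul t2 a3 (abs_nonneg _) (by positivity)
    have e2 : 4 * S * h ^ 2 = 16 * S / free d G ^ 2 := by rw [hh]; field_simp; ring
    have e3 : 16 * S / free d G ^ 2 ≤ 16 * d * S / free d G ^ 2 := by
      gcongr; nlinarith
    have e4 : 16 * d * S / free d G ^ 2 + 4 * d / free d G ^ 2 * (2 * S) =
        24 * d * S / free d G ^ 2 := by ring
    linarith
  refine (sum_le_sum key).trans (le_of_eq ?_)
  rw [sum_const, nsmul_eq_mul]
  change free d G * _ = _
  field_simp

/-- With `S = e ^ (X + 2 / U) * B ^ d`, the clock moves `U` terms by `2 S * (2 / U)` each and the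
edge moves two terms by `2 S` each, in total `8 S`. -/
theorem abs_weight_charlier_addEdge_sub_le {k : ℕ} (hk : k < d) (hU : 2 * (d : ℝ) ≤ free d G)
    (hX : 0 ≤ X) (hXB : X + 2 / free d G ≤ B) (hB : 1 ≤ B) {e : Sym2 V} (he : e ∈ available d G) :
    |weight (charlier k (X + 2 / free d G)) (addEdge G e) - weight (charlier k X) G| ≤
      8 * (Real.exp (X + 2 / free d G) * B ^ d) := by
  classical
  have hd : 1 ≤ d := by omega
  have hd' : (1 : ℝ) ≤ d := by exact_mod_cast hd
  have hU0 : 0 < free d G := by linarith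
  set h := 2 / free d G with hh
  have hh0 : 0 ≤ h := by positivity
  set S := Real.exp (X + h) * B ^ d with hS
  have hS0 : 0 ≤ S := by positivity
  rw [weight, weight, ← sum_sub_distrib]
  refine (abs_sum_le_sum_abs _ _).trans ?_
  have key : ∀ v, |charlier k (X + h) (deg (addEdge G e) v) - charlier k X (deg G v)| ≤
      (if v ∈ unsat d G then 2 * S * h else 0) + (if v ∈ e then (1 : ℝ) else 0) * (2 * S) := by
    intro v
    have b1 : |charlier k (X + h) (deg G v) - charlier k X (deg G v)| ≤
        if v ∈ unsat d G then 2 * S * h else 0 := by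
      split_ifs with hv
      · exact abs_charlier_sub_le hk hX hh0 hXB hB (deg G v)
      · have hv' : d ≤ deg G v := by simpa [mem_unsat] using hv
        rw [charlier_eq_zero (by omega), charlier_eq_zero (by omega)]
        simp
    rw [deg_addEdge he]
    by_cases hve : v ∈ e
    · rw [if_pos hve, if_pos hve]
      have a1 := abs_charlier_le hk (by linarith : 0 ≤ X + h) hXB hB (deg G v)
      have a2 := abs_charlier_le hk (by linarith : 0 ≤ X + h) hXB hB (deg G v + 1)
      have e1 : charlier k (X + h) (deg G v + 1) - charlier k X (deg G v) =
        (charlier k (X + h) (deg G v) - charlier k X (deg G v)) +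
          (charlier k (X + h) (deg G v + 1) - charlier k (X + h) (deg G v)) := by ring
      rw [e1]
      refine (abs_add_le _ _).trans (add_le_add b1 ?_)
      linarith [abs_sub (charlier k (X + h) (deg G v + 1)) (charlier k (X + h) (deg G v))]
    · rw [if_neg hve, if_neg hve, add_zero, zero_mul, add_zero]
      exact b1
  refine (sum_le_sum fun v _ => key v).trans (le_of_eq ?_)
  rw [sum_add_distrib, ← sum_mul]
  have h2 : ∑ v : V, (if v ∈ e then (1 : ℝ) else 0) = 2 := by
    exact_mod_cast sum_mem_eq_two (mem_available.1 he).1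
  rw [h2, sum_ite_mem, univ_inter, sum_const, nsmul_eq_mul]
  change free d G * _ + _ = _
  rw [hh]
  field_simp
  ring

/-- Adding `n ^ 2` to the deviation turns the additive variance bound of `sq_exp_mul_free_le` into a
purely multiplicative recursion. -/
theorem clockStep_deviation_le (hd : 1 ≤ d) (hU : 2 * (d : ℝ) ≤ free d G)
    (hX : 0 ≤ X) (hXB : X + 2 / free d G ≤ B) (hB : 1 ≤ B) :
    clockStep d (fun G X => deviation d G X + (Fintype.card V : ℝ) ^ 2) G X ≤
      (1 + 12000 * d ^ 6 * B ^ (4 * d) / free d G ^ 2) *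
        (deviation d G X + (Fintype.card V : ℝ) ^ 2) := by
  have hd' : (1 : ℝ) ≤ d := by exact_mod_cast hd
  have hU0 : 0 < free d G := by linarith
  have hY := sq_exp_mul_free_le d hd G hX (by linarith [show 0 ≤ 2 / free d G by positivity]) hB
  have hA := available_nonempty hd hU
  have hexp : Real.exp (X + 2 / free d G) ≤ 3 * Real.exp X := by
    rw [Real.exp_add, mul_comm]
    gcongr
    have : 2 / free d G ≤ 1 := by rw [div_le_one hU0]; linarith
    calc Real.exp (2 / free d G) ≤ Real.exp 1 := Real.exp_le_exp.2 this
      _ ≤ 3 := by linarith [Real.exp_one_lt_d9]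
  have key : ∀ k ∈ range d,
      stepExp d G (fun H => (weight (charlier k (X + 2 / free d G)) H - startVal V k) ^ 2) ≤
        (1 + 1 / free d G ^ 2) * (weight (charlier k X) G - startVal V k) ^ 2 +
          640 * d ^ 2 * (free d G * (3 * Real.exp X * B ^ d)) ^ 2 / free d G ^ 2 := by
    intro k hk
    have hk' := mem_range.1 hk
    have b1 := abs_stepExp_weight_charlier_sub_le hk' hU hX hXB hB
    have b2 : ∀ e ∈ available d G, _ := fun e he =>
      abs_weight_charlier_addEdge_sub_le hk' hU hX hXB hB he
    have hS : Real.exp (X + 2 / free d G) * B ^ d ≤ 3 * Real.exp X * B ^ d := by gcongr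
    set S := 3 * Real.exp X * B ^ d
    set T := Real.exp (X + 2 / free d G) * B ^ d
    set h := 2 / free d G
    set M := weight (charlier k X) G
    set m := startVal V k
    have hT0 : 0 ≤ T := by positivity
    have hS0 : 0 ≤ S := by positivity
    -- Expand the square about the old value `M`: the linear term sees only the drift, the quadratic
    -- term is at most `(8 S) ^ 2`.
    have h1 : stepExp d G (fun H => (weight (charlier k (X + h)) H - m) ^ 2) ≤
        stepExp d G (fun H => 2 * (M - m) * weight (charlier k (X + h)) H +
          ((M - m) ^ 2 - 2 * (M - m) * M + 64 * S ^ 2)) := by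
      refine stepExp_mono (fun e he => ?_) (fun h0 => absurd hA h0)
      have := b2 e he
      have h3 : (weight (charlier k (X + h)) (addEdge G e) - M) ^ 2 ≤ (8 * S) ^ 2 := by
        rw [← sq_abs]
        gcongr
        linarith
      nlinarith
    rw [stepExp_add, stepExp_const_mul, stepExp_const] at h1
    set E := stepExp d G (weight (charlier k (X + h)))
    have h4 : |E - M| ≤ 24 * d * S / free d G := b1.trans (by gcongr)
    -- The arithmetic-geometric mean inequality splits drift times deviation; `24 ^ 2 + 64 = 640` is
    -- the constant above.
    have h5 : 2 * (M - m) * (E - M) ≤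
        1 / free d G ^ 2 * (M - m) ^ 2 + (24 * d * S) ^ 2 := by
      have : (M - m) * (E - M) ≤ |M - m| * (24 * d * S / free d G) := by
        refine (le_abs_self _).trans ?_
        rw [abs_mul]
        gcongr
      have h6 : 2 * (|M - m| * (24 * d * S / free d G)) ≤
          1 / free d G ^ 2 * (M - m) ^ 2 + (24 * d * S) ^ 2 := by
        rw [← sq_abs (M - m)]
        have := sq_nonneg (|M - m| / free d G - 24 * d * S)
        have e : (|M - m| / free d G - 24 * d * S) ^ 2 = 1 / free d G ^ 2 * |M - m| ^ 2
          + (24 * d * S) ^ 2 - 2 * (|M - m| * (24 * d * S / free d G)) := by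
          field_simp
          ring
        linarith
      linarith
    have h7 : 640 * d ^ 2 * (free d G * S) ^ 2 / free d G ^ 2 = 640 * d ^ 2 * S ^ 2 := by
      field_simp
    rw [h7]
    have h8 : 64 * S ^ 2 ≤ 64 * d ^ 2 * S ^ 2 := by
      have : (1 : ℝ) ≤ d ^ 2 := one_le_pow₀ hd'
      nlinarith [sq_nonneg S]
    nlinarith
  have hsum : clockStep d (fun G X => deviation d G X + (Fintype.card V : ℝ) ^ 2) G X =
      ∑ k ∈ range d, stepExp d G
        (fun H => (weight (charlier k (X + 2 / free d G)) H - startVal V k) ^ 2)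
        + (Fintype.card V : ℝ) ^ 2 := by
    unfold clockStep
    rw [stepExp_add, stepExp_const, ← stepExp_sum]
    rfl
  rw [hsum]
  have h1 := sum_le_sum key
  rw [sum_add_distrib, ← mul_sum, sum_const, card_range, nsmul_eq_mul] at h1
  change _ ≤ (1 + 1 / free d G ^ 2) * deviation d G X + _ at h1
  have hdev := deviation_nonneg d G X
  set D := deviation d G X
  set n := (Fintype.card V : ℝ)
  have hN : 0 ≤ D + n ^ 2 := by positivity
  have h2 : (free d G * (3 * Real.exp X * B ^ d)) ^ 2 ≤ 18 * d ^ 3 * B ^ (4 * d) * (D + n ^ 2) := by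
    have e1 : (free d G * (3 * Real.exp X * B ^ d)) ^ 2 =
        9 * B ^ (2 * d) * (Real.exp X * free d G) ^ 2 := by rw [pow_mul' B 2 d]; ring
    have e2 : B ^ (4 * d) = B ^ (2 * d) * B ^ (2 * d) := by rw [← pow_add]; congr 1; ring
    rw [e1, e2]
    have := mul_le_mul_of_nonneg_left hY (show 0 ≤ 9 * B ^ (2 * d) by positivity)
    linarith
  have h3 : (d : ℝ) * (640 * d ^ 2 * (free d G * (3 * Real.exp X * B ^ d)) ^ 2 / free d G ^ 2) ≤
      11520 * d ^ 6 * B ^ (4 * d) / free d G ^ 2 * (D + n ^ 2) := by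
    have := mul_le_mul_of_nonneg_left h2 (show 0 ≤ 640 * (d : ℝ) ^ 3 / free d G ^ 2 by positivity)
    calc _ = 640 * (d : ℝ) ^ 3 / free d G ^ 2 * (free d G * (3 * Real.exp X * B ^ d)) ^ 2 := by ring
      _ ≤ _ := this
      _ = _ := by ring
  have h4 : 1 / free d G ^ 2 * D ≤ 480 * d ^ 6 * B ^ (4 * d) / free d G ^ 2 * (D + n ^ 2) := by
    have hb : 1 ≤ (d : ℝ) ^ 6 * B ^ (4 * d) :=
      one_le_mul_of_one_le_of_one_le (one_le_pow₀ hd') (one_le_pow₀ hB)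
    apply mul_le_mul _ (by nlinarith) hdev (by positivity)
    gcongr
    nlinarith
  have e5 : 12000 * (d : ℝ) ^ 6 * B ^ (4 * d) / free d G ^ 2 =
      480 * d ^ 6 * B ^ (4 * d) / free d G ^ 2 + 11520 * d ^ 6 * B ^ (4 * d) / free d G ^ 2 := by
    ring
  rw [e5]
  nlinarith

theorem Reach.clock_le {s : ℕ} (hd : 1 ≤ d) (h : Reach d s G X)
    (hs : 2 * (d : ℝ) ^ 2 ≤ deficit V d s) (hB : d * Real.log (Fintype.card V) + 1 ≤ B) :
    0 ≤ X ∧ X + 2 / free d G ≤ B := by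
  have hd' : (1 : ℝ) ≤ d := by exact_mod_cast hd
  obtain ⟨h1, h2⟩ := h.clock_bounds hd hs
  have h3 : deficit V d s ≤ deficit V d 0 := deficit_mono (by omega)
  have h4 := pos_of_two_mul_sq_le hd hs
  have hU := h.le_free hd hs
  constructor
  · refine le_trans (Real.log_nonneg ?_) h1
    rw [one_le_div (by linarith)]; linarith
  · have h5 : 2 / free d G ≤ 1 := by rw [div_le_one (by linarith)]; linarith
    have h6 : deficit V d 0 / deficit V d s ≤ Fintype.card V := by
      rw [div_le_iff₀ (by linarith), deficit_zero, mul_comm]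
      gcongr
      nlinarith
    have h7 : Real.log (deficit V d 0 / deficit V d s) ≤ Real.log (Fintype.card V) :=
      Real.log_le_log (by apply div_pos <;> linarith) h6
    have := mul_le_mul_of_nonneg_left h7 (by linarith : (0 : ℝ) ≤ d)
    linarith

/-- As `1 / U ≤ d / ρ`, the relative growth per step is at most `2 c / ρ ^ 2`, below the increment
of `c / ρ` as `ρ` drops by 2. The deviation thus stays well below `n ^ 2` while `ρ` is large
compared with `B ^ (4 d)`. -/
theorem expAt_deviation_le {s : ℕ} (hd : 1 ≤ d) (hs : 2 * (d : ℝ) ^ 2 ≤ deficit V d s)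
    (hB : d * Real.log (Fintype.card V) + 1 ≤ B) (hB1 : 1 ≤ B) :
    expAt d s (fun (G : SimpleGraph V) X => deviation d G X) ≤
      (Real.exp (6000 * d ^ 8 * B ^ (4 * d) / deficit V d s) - 1) * (Fintype.card V : ℝ) ^ 2 := by
  have hd' : (1 : ℝ) ≤ d := by exact_mod_cast hd
  set c := 6000 * (d : ℝ) ^ 8 * B ^ (4 * d)
  have hc : 0 ≤ c := by positivity
  have main := le_of_succ_le_exp (u := fun s => expAt d s (fun (G : SimpleGraph V) X =>
    deviation d G X + (Fintype.card V : ℝ) ^ 2)) (g := fun s => c / deficit V d s) (Nat.zero_le s)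
    (fun t _ ht => ?_)
  · simp only [expAt_zero, deviation_start, zero_add, expAt_add, expAt_const] at main
    have h1 : Real.exp (c / deficit V d s - c / deficit V d 0) ≤ Real.exp (c / deficit V d s) := by
      apply Real.exp_le_exp.2
      have h3 : deficit V d s ≤ deficit V d 0 := deficit_mono (by omega)
      have h4 := pos_of_two_mul_sq_le hd hs
      have : 0 ≤ c / deficit V d 0 := div_nonneg hc (by linarith)
      linarith
    have h2 := mul_le_mul_of_nonneg_right h1 (sq_nonneg (Fintype.card V : ℝ))
    linarith
  · have h1 : 2 * (d : ℝ) ^ 2 ≤ deficit V d t - 2 := by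
      rw [← deficit_succ (V := V)]
      exact hs.trans (deficit_mono (by omega))
    have h2 := pos_of_two_mul_sq_le hd h1
    rw [expAt_succ, ← expAt_const_mul]
    refine expAt_mono fun G X hR => ?_
    have hs' : 2 * (d : ℝ) ^ 2 ≤ deficit V d t := by linarith
    obtain ⟨hX, hXB⟩ := hR.clock_le hd hs' hB
    refine (clockStep_deviation_le hd (hR.le_free hd hs') hX hXB hB1).trans ?_
    refine mul_le_mul_of_nonneg_right ?_ (add_nonneg (deviation_nonneg _ _ _) (sq_nonneg _))
    rw [add_comm]
    refine le_trans ?_ (Real.add_one_le_exp _)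
    gcongr
    simp only [deficit_succ]
    have h3 := hR.one_div_free_le hd hs'
    have hU := hR.le_free hd hs'
    set ρ := deficit V d t
    have hρ : 0 < ρ - 2 := by linarith
    have hρ' : 0 < ρ := by linarith
    have e1 : c / (ρ - 2) - c / ρ = 2 * c * (1 / ((ρ - 2) * ρ)) := by field_simp; ring
    have e2 : 12000 * (d : ℝ) ^ 6 * B ^ (4 * d) / free d G ^ 2 =
        12000 * (d : ℝ) ^ 6 * B ^ (4 * d) * (1 / free d G) ^ 2 := by ring
    have hU0 : 0 ≤ 1 / free d G := one_div_nonneg.2 (free_nonneg _ _)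
    rw [e1, e2]
    calc 12000 * (d : ℝ) ^ 6 * B ^ (4 * d) * (1 / free d G) ^ 2 ≤
        12000 * (d : ℝ) ^ 6 * B ^ (4 * d) * (d / ρ) ^ 2 := by gcongr
      _ = 2 * c * (1 / (ρ * ρ)) := by simp only [c]; field_simp; norm_num
      _ ≤ 2 * c * (1 / ((ρ - 2) * ρ)) := by gcongr; linarith

end Martingales

end RandomDGraph

end

/-! ### Degree profile at the end of the first phase. -/

noncomputable section

namespace RandomDGraph

open Finset Filter Topology
open scoped Nat

section BurnIn

theorem tendsto_log_natCast : Tendsto (fun n : ℕ => Real.log n) atTop atTop :=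
  Real.tendsto_log_atTop.comp tendsto_natCast_atTop_atTop

theorem deficit_maxEdges_sub {d n t : ℕ} (ht : t ≤ maxEdges d n) :
    deficit (Fin n) d (maxEdges d n - t) = 2 * t + ((d * n % 2 : ℕ) : ℝ) := by
  unfold deficit
  rw [Nat.cast_sub ht, Fintype.card_fin]
  have : d * n % 2 + 2 * maxEdges d n = d * n := Nat.mod_add_div _ _
  have h : ((d * n % 2 : ℕ) : ℝ) + 2 * maxEdges d n = d * n := by exact_mod_cast this
  linarith

theorem deficit_maxEdges_sub_bounds {d n t : ℕ} (ht : t ≤ maxEdges d n) :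
    2 * (t : ℝ) ≤ deficit (Fin n) d (maxEdges d n - t) ∧
      deficit (Fin n) d (maxEdges d n - t) ≤ 2 * t + 1 := by
  rw [deficit_maxEdges_sub ht]
  have h : ((d * n % 2 : ℕ) : ℝ) ≤ 1 := by
    exact_mod_cast Nat.le_of_lt_succ (Nat.mod_lt (d * n) (by norm_num : 0 < 2))
  constructor
  · linarith [Nat.cast_nonneg (α := ℝ) (d * n % 2)]
  · linarith

theorem eventually_le_maxEdges {d : ℕ} (hd : 2 ≤ d) {t : ℕ → ℕ} {K : ℕ}
    (h : ∀ᶠ n : ℕ in atTop, (t n : ℝ) ≤ 2 * Real.log n ^ K) :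
    ∀ᶠ n in atTop, t n ≤ maxEdges d n := by
  have h1 := ((Real.isLittleO_pow_log_id_atTop (n := K)).comp_tendsto
    tendsto_natCast_atTop_atTop).bound (show (0 : ℝ) < 1 / 2 by norm_num)
  filter_upwards [h, h1] with n h2 h3
  simp only [Function.comp, id, Real.norm_natCast] at h3
  have h4 := le_of_abs_le h3
  have h5 : (t n : ℝ) ≤ n := by linarith
  have h6 : t n ≤ n := by exact_mod_cast h5
  refine h6.trans ?_
  unfold maxEdges
  rw [Nat.le_div_iff_mul_le (by norm_num)]
  nlinarith

/-- The number of steps of the first phase, which leaves a deficit of polylogarithmic size. -/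
def burnIn (d n : ℕ) : ℕ := maxEdges d n - ⌈Real.log n ^ (10 * d + 3)⌉₊

theorem eventually_ceil_le (K : ℕ) :
    ∀ᶠ n : ℕ in atTop, (⌈Real.log n ^ K⌉₊ : ℝ) ≤ 2 * Real.log n ^ K := by
  filter_upwards [tendsto_log_natCast.eventually_ge_atTop 1] with n hn
  have h1 : 1 ≤ Real.log n ^ K := one_le_pow₀ hn
  have := Nat.ceil_lt_add_one (zero_le_one.trans h1)
  linarith

theorem eventually_burnIn_bounds {d : ℕ} (hd : 2 ≤ d) :
    ∀ᶠ n : ℕ in atTop, Real.log n ^ (10 * d + 3) ≤ deficit (Fin n) d (burnIn d n) ∧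
      deficit (Fin n) d (burnIn d n) ≤ 5 * Real.log n ^ (10 * d + 3) := by
  filter_upwards [eventually_le_maxEdges hd (eventually_ceil_le (10 * d + 3)),
    eventually_ceil_le (10 * d + 3), tendsto_log_natCast.eventually_ge_atTop 1] with n h1 h2 h3
  have h4 : 1 ≤ Real.log n ^ (10 * d + 3) := one_le_pow₀ h3
  obtain ⟨h5, h6⟩ := deficit_maxEdges_sub_bounds h1
  have h7 := Nat.le_ceil (Real.log n ^ (10 * d + 3))
  unfold burnIn
  constructor <;> linarith

theorem tendsto_deficit_burnIn {d : ℕ} (hd : 2 ≤ d) :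
    Tendsto (fun n => deficit (Fin n) d (burnIn d n)) atTop atTop :=
  tendsto_atTop_mono' _ ((eventually_burnIn_bounds hd).mono fun _ h => h.1)
    ((tendsto_pow_atTop (by omega)).comp tendsto_log_natCast)

/-- The filter of the states at the end of the first phase in which the deviation is small,
uniformly as the number of vertices grows. -/
def goodFilter (d : ℕ) : Filter (Σ n : ℕ, SimpleGraph (Fin n) × ℝ) :=
  comap Sigma.fst atTop ⊓ 𝓟 {p | Reach d (burnIn d p.1) p.2.1 p.2.2 ∧
    deviation d p.2.1 p.2.2 * Real.log p.1 ^ (2 * d + 2) ≤ (p.1 : ℝ) ^ 2}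

theorem eventually_goodFilter {d : ℕ} {P : (Σ n : ℕ, SimpleGraph (Fin n) × ℝ) → Prop} :
    (∀ᶠ p in goodFilter d, P p) ↔ ∀ᶠ n in atTop, ∀ G X, Reach d (burnIn d n) G X →
      deviation d G X * Real.log n ^ (2 * d + 2) ≤ (n : ℝ) ^ 2 → P ⟨n, G, X⟩ := by
  unfold goodFilter
  rw [eventually_inf_principal, eventually_comap]
  refine eventually_congr (Eventually.of_forall fun n => ?_)
  constructor
  · intro h G X h1 h2
    exact h ⟨n, G, X⟩ rfl ⟨h1, h2⟩
  · rintro h ⟨m, G, X⟩ rfl ⟨h1, h2⟩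
    exact h G X h1 h2

theorem tendsto_fst_goodFilter (d : ℕ) : Tendsto Sigma.fst (goodFilter d) atTop :=
  tendsto_comap.mono_left inf_le_left

theorem tendsto_log_goodFilter (d : ℕ) :
    Tendsto (fun p : Σ n : ℕ, SimpleGraph (Fin n) × ℝ => Real.log p.1) (goodFilter d) atTop :=
  tendsto_log_natCast.comp (tendsto_fst_goodFilter d)

theorem eventually_goodFilter_reach {d : ℕ} (hd : 2 ≤ d) :
    ∀ᶠ p in goodFilter d, Reach d (burnIn d p.1) p.2.1 p.2.2 ∧
      2 * (d : ℝ) ^ 2 ≤ deficit (Fin p.1) d (burnIn d p.1) ∧ 1 ≤ Real.log p.1 ∧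
      deficit (Fin p.1) d (burnIn d p.1) ≤ 5 * Real.log p.1 ^ (10 * d + 3) := by
  rw [eventually_goodFilter]
  filter_upwards [eventually_burnIn_bounds hd, tendsto_log_natCast.eventually_ge_atTop 1,
    (tendsto_deficit_burnIn hd).eventually_ge_atTop (2 * (d : ℝ) ^ 2)] with n h1 h2 h3 G X h4 _
  exact ⟨h4, h3, h2, h1.2⟩

theorem natCast_pos_of_one_le_log {n : ℕ} (h : 1 ≤ Real.log n) : (0 : ℝ) < n := by
  rcases Nat.eq_zero_or_pos n with rfl | hn
  · simp at h; linarith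
  · exact_mod_cast hn

/-- In a good state the numbers of vertices of given degree follow the Poisson profile. -/
theorem eventually_goodFilter_profile {d : ℕ} (hd : 2 ≤ d) :
    ∀ᶠ p in goodFilter d, ∀ i < d,
      |Real.exp p.2.2 * degCount i p.2.1 / p.1 - p.2.2 ^ i / i !| ≤
        d * (2 * d) ^ d / Real.log p.1 := by
  have hd' : (2 : ℝ) ≤ d := by exact_mod_cast hd
  have h0 : ∀ᶠ p in goodFilter d,
      deviation d p.2.1 p.2.2 * Real.log p.1 ^ (2 * d + 2) ≤ (p.1 : ℝ) ^ 2 := by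
    rw [eventually_goodFilter]
    exact Eventually.of_forall fun n G X _ h => h
  filter_upwards [eventually_goodFilter_reach hd, h0] with ⟨n, G, X⟩ ⟨h1, h2, h3, _⟩ h4 i hi
  simp only at h1 h2 h3 h4 ⊢
  have hn := natCast_pos_of_one_le_log h3
  set L := Real.log n
  have hL0 : 0 < L := by linarith
  obtain ⟨hX, hXB⟩ := h1.clock_le (B := d * L + 1) (by omega) h2 (by rw [Fintype.card_fin])
  have hU := h1.le_free (by omega) h2
  have hXB' : X ≤ d * L + 1 := by
    have : 0 ≤ 2 / free d G := div_nonneg (by norm_num) (free_nonneg _ _)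
    linarith
  have e := abs_exp_mul_degCount_sub_le hi G hX hXB' (by nlinarith)
  rw [Fintype.card_fin] at e
  have hS := sq_sum_abs_le_deviation d G X
  set S := ∑ k ∈ range d, |weight (charlier k X) G - startVal (Fin n) k|
  have hS0 : 0 ≤ S := sum_nonneg fun _ _ => abs_nonneg _
  -- One power of `L` more than the factor `B ^ d` of the inversion can consume.
  have hS1 : S ≤ d * n / L ^ (d + 1) := by
    refine le_of_sq_le_sq ?_ (by positivity)
    rw [div_pow, le_div_iff₀ (by positivity), ← pow_mul, show (d + 1) * 2 = 2 * d + 2 by ring]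
    calc S ^ 2 * L ^ (2 * d + 2) ≤ d * deviation d G X * L ^ (2 * d + 2) := by gcongr
      _ = d * (deviation d G X * L ^ (2 * d + 2)) := by ring
      _ ≤ d * (n : ℝ) ^ 2 := by gcongr
      _ ≤ (d * n) ^ 2 := by
        rw [mul_pow]; gcongr; nlinarith
  have e2 : Real.exp X * degCount i G / n - X ^ i / i ! =
      (Real.exp X * degCount i G - n * (X ^ i / i !)) / n := by field_simp
  rw [e2, abs_div, abs_of_pos hn, div_le_iff₀ hn]
  refine e.trans ?_
  calc (d * L + 1) ^ d * S ≤ (2 * d * L) ^ d * (d * n / L ^ (d + 1)) := by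
        gcongr; nlinarith
    _ = _ := by rw [mul_pow, pow_succ]; field_simp

theorem tendsto_log_div_goodFilter (d : ℕ) (a b : ℝ) :
    Tendsto (fun p : Σ n : ℕ, SimpleGraph (Fin n) × ℝ =>
      (a + b * Real.log (Real.log p.1)) / Real.log p.1) (goodFilter d) (𝓝 0) := by
  have h1 : Tendsto (fun x : ℝ => a / x) atTop (𝓝 0) := tendsto_const_nhds.div_atTop tendsto_id
  have h2 : Tendsto (fun x : ℝ => Real.log x / x) atTop (𝓝 0) :=
    Real.isLittleO_log_id_atTop.tendsto_div_nhds_zero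
  have h3 := (h1.add (h2.const_mul b)).comp (tendsto_log_goodFilter d)
  simp only [mul_zero, add_zero] at h3
  refine h3.congr fun p => ?_
  simp only [Function.comp]
  ring

/-- The lower bound is deterministic, since `ρ` has fallen to a power of `log n`. The deterministic
upper bound is too large by a factor `d`; instead the profile gives `e ^ X U ≤ C n (log n) ^ d`, and
`U ≥ 1`. -/
theorem tendsto_clock_div_log {d : ℕ} (hd : 2 ≤ d) :
    Tendsto (fun p : Σ n : ℕ, SimpleGraph (Fin n) × ℝ => p.2.2 / Real.log p.1)
      (goodFilter d) (𝓝 1) := by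
  have hd' : (2 : ℝ) ≤ d := by exact_mod_cast hd
  set C : ℝ := d * ((2 * d) ^ d + d * (2 * d) ^ d) with hC
  have hC0 : 0 < C := by positivity
  have lo := (tendsto_log_div_goodFilter d (Real.log 7) ((10 * d + 3 : ℕ) : ℝ)).const_sub 1
  have hi := (tendsto_log_div_goodFilter d (Real.log C) d).const_add 1
  rw [sub_zero] at lo
  rw [add_zero] at hi
  refine tendsto_of_tendsto_of_tendsto_of_le_of_le' lo hi ?_ ?_
  · filter_upwards [eventually_goodFilter_reach hd] with ⟨n, G, X⟩ ⟨h1, h2, h3, h4⟩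
    simp only at h1 h2 h3 h4 ⊢
    have hn := natCast_pos_of_one_le_log h3
    have hρ := pos_of_two_mul_sq_le (by omega) h2
    have hX := (h1.clock_bounds (by omega) h2).1
    set ρ := deficit (Fin n) d (burnIn d n)
    have hL0 : 0 < Real.log n := by linarith
    have hpow : 1 ≤ Real.log n ^ (10 * d + 3) := one_le_pow₀ h3
    -- The 7 is 5 from the bound on `ρ` plus 2 from the shift in `Reach.clock_bounds`.
    have k1 : Real.log n - Real.log (7 * Real.log n ^ (10 * d + 3)) ≤ X := by
      refine le_trans ?_ hX
      rw [← Real.log_div hn.ne' (by positivity)]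
      apply Real.log_le_log (by positivity)
      rw [deficit_zero, Fintype.card_fin]
      apply div_le_div₀ (by positivity) (by nlinarith) (by linarith) (by linarith)
    rw [Real.log_mul (by norm_num) (by positivity), Real.log_pow] at k1
    rw [le_div_iff₀ hL0, sub_mul, div_mul_cancel₀ _ hL0.ne', one_mul]
    exact k1
  · filter_upwards [eventually_goodFilter_reach hd, eventually_goodFilter_profile hd]
      with ⟨n, G, X⟩ ⟨h1, h2, h3, h4⟩ h5
    simp only at h1 h2 h3 h4 h5 ⊢
    have hn := natCast_pos_of_one_le_log h3
    have hL0 : 0 < Real.log n := by linarith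
    set L := Real.log n with hL
    obtain ⟨hX, hXB⟩ := h1.clock_le (B := d * L + 1) (by omega) h2 (by rw [Fintype.card_fin])
    have hU := h1.le_free (by omega) h2
    have hXB' : X ≤ 2 * d * L := by
      have : 0 ≤ 2 / free d G := div_nonneg (by norm_num) (free_nonneg _ _)
      nlinarith
    have hLd : 1 ≤ L ^ d := one_le_pow₀ h3
    have hB1 : 1 ≤ 2 * d * L := by nlinarith
    have k1 : Real.exp X * free d G ≤ n * (C * L ^ d) := by
      rw [free_eq_sum_degCount, mul_sum]
      have : ∀ i ∈ range d, Real.exp X * degCount i G ≤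
          n * (((2 * d) ^ d + d * (2 * d) ^ d) * L ^ d) := by
        intro i hi
        have hi' := mem_range.1 hi
        have a1 := (abs_le.1 (h5 i hi')).2
        have a2 : X ^ i / (i ! : ℝ) ≤ (2 * d) ^ d * L ^ d :=
          calc X ^ i / (i ! : ℝ) ≤ X ^ i :=
                div_le_self (by positivity)
                  (by exact_mod_cast Nat.one_le_iff_ne_zero.2 (Nat.factorial_ne_zero _))
            _ ≤ (2 * d * L) ^ i := by gcongr
            _ ≤ (2 * d * L) ^ d := pow_le_pow_right₀ hB1 (by omega)
            _ = _ := by rw [mul_pow]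
        have a3 : (d : ℝ) * (2 * d) ^ d / L ≤ d * (2 * d) ^ d * L ^ d :=
          calc (d : ℝ) * (2 * d) ^ d / L ≤ d * (2 * d) ^ d := div_le_self (by positivity) h3
            _ ≤ _ := le_mul_of_one_le_right (by positivity) hLd
        have a4 : Real.exp X * degCount i G / n ≤ ((2 * d) ^ d + d * (2 * d) ^ d) * L ^ d := by
          linarith
        rw [div_le_iff₀ hn] at a4
        linarith
      have := sum_le_sum this
      rw [sum_const, card_range, nsmul_eq_mul] at this
      refine this.trans (le_of_eq ?_)
      rw [hC]; ring
    have k2 : Real.exp X ≤ n * (C * L ^ d) := by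
      have : Real.exp X ≤ Real.exp X * free d G :=
        le_mul_of_one_le_right (Real.exp_pos X).le (by linarith)
      linarith
    have k3 : X ≤ L + (Real.log C + d * Real.log L) := by
      rw [← Real.log_exp X, hL, ← Real.log_pow, ← Real.log_mul hC0.ne' (by positivity),
        ← Real.log_mul hn.ne' (by positivity)]
      exact Real.log_le_log (Real.exp_pos X) k2
    rw [div_le_iff₀ hL0, add_mul, div_mul_cancel₀ _ hL0.ne', one_mul]
    exact k3

theorem tendsto_scaled_degCount {d : ℕ} (hd : 2 ≤ d) {i : ℕ} (hi : i < d) :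
    Tendsto (fun p : Σ n : ℕ, SimpleGraph (Fin n) × ℝ =>
      Real.exp p.2.2 * degCount i p.2.1 / p.1 / Real.log p.1 ^ i) (goodFilter d)
      (𝓝 (1 / i !)) := by
  have h1 : Tendsto (fun p : Σ n : ℕ, SimpleGraph (Fin n) × ℝ => (p.2.2 / Real.log p.1) ^ i / i !)
      (goodFilter d) (𝓝 (1 / i !)) := by
    simpa using ((tendsto_clock_div_log hd).pow i).div_const (i ! : ℝ)
  have h2 : Tendsto (fun p : Σ n : ℕ, SimpleGraph (Fin n) × ℝ =>
      d * (2 * d) ^ d / Real.log p.1) (goodFilter d) (𝓝 0) :=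
    tendsto_const_nhds.div_atTop (tendsto_log_goodFilter d)
  have h3 : Tendsto (fun p : Σ n : ℕ, SimpleGraph (Fin n) × ℝ =>
      Real.exp p.2.2 * degCount i p.2.1 / p.1 / Real.log p.1 ^ i -
        (p.2.2 / Real.log p.1) ^ i / i !) (goodFilter d) (𝓝 0) := by
    refine squeeze_zero_norm' ?_ h2
    filter_upwards [eventually_goodFilter_reach hd, eventually_goodFilter_profile hd]
      with ⟨n, G, X⟩ ⟨_, _, h3, _⟩ h5
    simp only at h3 h5 ⊢
    have hL0 : 0 < Real.log n := by linarith
    have e : Real.exp X * degCount i G / n / Real.log n ^ i - (X / Real.log n) ^ i / i ! =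
        (Real.exp X * degCount i G / n - X ^ i / i !) / Real.log n ^ i := by
      rw [div_pow]; field_simp
    rw [e, Real.norm_eq_abs, abs_div, abs_of_pos (by positivity : 0 < Real.log n ^ i)]
    exact (div_le_self (abs_nonneg _) (one_le_pow₀ h3)).trans (h5 i hi)
  simpa using h3.add h1

theorem weight_eq_sum_degCount {V : Type*} [Fintype V] {d : ℕ} {a : ℕ → ℝ} {G : SimpleGraph V}
    (h : ∀ v, d ≤ deg G v → a (deg G v) = 0) :
    weight a G = ∑ i ∈ range d, a i * degCount i G := by
  classical
  simp_rw [degCount_eq_weight, weight, mul_sum]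
  rw [sum_comm]
  refine sum_congr rfl fun v _ => ?_
  unfold isDeg
  by_cases hv : deg G v < d
  · rw [sum_eq_single (deg G v)]
    · simp
    · intro i _ hi
      rw [if_neg (Ne.symm hi), mul_zero]
    · intro h0
      exact absurd (mem_range.2 hv) h0
  · rw [h v (by omega), sum_eq_zero]
    intro i hi
    rw [if_neg (by simp at hi; omega), mul_zero]

/-- The deficit is the sum of `(d - i)` times the count of degree `i`; only `i = d - 1` survives the
scaling, which the factor `0 ^ (d - 1 - i)` encodes. -/
theorem tendsto_scaled_deficit {d : ℕ} (hd : 2 ≤ d) :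
    Tendsto (fun p : Σ n : ℕ, SimpleGraph (Fin n) × ℝ =>
      Real.exp p.2.2 * deficit (Fin p.1) d (burnIn d p.1) / p.1 / Real.log p.1 ^ (d - 1))
      (goodFilter d) (𝓝 (1 / (d - 1)!)) := by
  have h1 : Tendsto (fun p : Σ n : ℕ, SimpleGraph (Fin n) × ℝ => ∑ i ∈ range d,
      ((d : ℝ) - i) * (Real.exp p.2.2 * degCount i p.2.1 / p.1 / Real.log p.1 ^ i *
        (1 / Real.log p.1) ^ (d - 1 - i)))
      (goodFilter d) (𝓝 (∑ i ∈ range d, ((d : ℝ) - i) * (1 / (i ! : ℝ) * 0 ^ (d - 1 - i)))) := by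
    refine tendsto_finsetSum _ fun i hi => ?_
    have h2 : Tendsto (fun p : Σ n : ℕ, SimpleGraph (Fin n) × ℝ => 1 / Real.log p.1)
        (goodFilter d) (𝓝 0) := tendsto_const_nhds.div_atTop (tendsto_log_goodFilter d)
    exact ((tendsto_scaled_degCount hd (mem_range.1 hi)).mul (h2.pow _)).const_mul _
  have e : ∑ i ∈ range d, ((d : ℝ) - i) * (1 / (i ! : ℝ) * 0 ^ (d - 1 - i)) = 1 / (d - 1)! := by
    rw [sum_eq_single (d - 1)]
    · simp [Nat.cast_sub (by omega : 1 ≤ d)]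
    · intro i hi hi'
      have : d - 1 - i ≠ 0 := by simp at hi; omega
      rw [zero_pow this]; ring
    · intro h; exact absurd (mem_range.2 (by omega)) h
  rw [e] at h1
  refine h1.congr' ?_
  filter_upwards [eventually_goodFilter_reach hd] with ⟨n, G, X⟩ ⟨h1, h2, h3, _⟩
  simp only at h1 h2 h3 ⊢
  have hL0 : 0 < Real.log n := by linarith
  have hn := natCast_pos_of_one_le_log h3
  rw [← h1.sum_missing (by omega) h2]
  have := weight_eq_sum_degCount (d := d) (a := fun i => (d : ℝ) - i) (G := G) fun v hv => by
    rw [le_antisymm (h1.deg_le v) hv, sub_self]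
  unfold weight at this
  rw [this, mul_sum, sum_div, sum_div]
  refine sum_congr rfl fun i hi => ?_
  have hi' : d - 1 = i + (d - 1 - i) := by simp at hi; omega
  have e2 : Real.log n ^ (d - 1) = Real.log n ^ i * Real.log n ^ (d - 1 - i) := by
    rw [← pow_add, ← hi']
  rw [e2, div_pow, one_pow]
  field_simp

/-- The limiting constant `(d - 1)! / j!`. -/
def limitConst (d j : ℕ) : ℝ := (d - 1)! / j !

theorem limitConst_pos (d j : ℕ) : 0 < limitConst d j := by unfold limitConst; positivity

theorem tendsto_degCount_ratio {d : ℕ} (hd : 2 ≤ d) {i : ℕ} (hi : i < d) :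
    Tendsto (fun p : Σ n : ℕ, SimpleGraph (Fin n) × ℝ =>
      degCount i p.2.1 / deficit (Fin p.1) d (burnIn d p.1) * Real.log p.1 ^ (d - 1 - i))
      (goodFilter d) (𝓝 (limitConst d i)) := by
  have h1 := (tendsto_scaled_degCount hd hi).div (tendsto_scaled_deficit hd) (by positivity)
  have e : 1 / (i ! : ℝ) / (1 / (d - 1)!) = limitConst d i := by
    unfold limitConst; field_simp
  rw [e] at h1
  refine h1.congr' ?_
  filter_upwards [eventually_goodFilter_reach hd] with ⟨n, G, X⟩ ⟨h1, h2, h3, _⟩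
  simp only [Pi.div_apply] at h1 h2 h3 ⊢
  have hL0 : 0 < Real.log n := by linarith
  have hn := natCast_pos_of_one_le_log h3
  have hρ : 0 < deficit (Fin n) d (burnIn d n) := by
    linarith [pos_of_two_mul_sq_le (by omega) h2]
  have e2 : Real.log n ^ (d - 1) = Real.log n ^ i * Real.log n ^ (d - 1 - i) := by
    rw [← pow_add]; congr 1; omega
  have := Real.exp_pos X
  rw [e2]
  field_simp

/-- Degree `i < j` is rarer than `j` by `(log n) ^ (j - i)`, while its weight is only the square
root of that. This is why `θ = √(log n)` serves. -/
theorem tendsto_weight_ratio {d : ℕ} (hd : 2 ≤ d) {j : ℕ} (hj : j < d) :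
    Tendsto (fun p : Σ n : ℕ, SimpleGraph (Fin n) × ℝ =>
      weight (geom (√(Real.log p.1)) j) p.2.1 / deficit (Fin p.1) d (burnIn d p.1) *
        Real.log p.1 ^ (d - 1 - j)) (goodFilter d) (𝓝 (limitConst d j)) := by
  have h1 : Tendsto (fun p : Σ n : ℕ, SimpleGraph (Fin n) × ℝ => ∑ i ∈ range (j + 1),
      (1 / √(Real.log p.1)) ^ (j - i) * (degCount i p.2.1 / deficit (Fin p.1) d (burnIn d p.1) *
        Real.log p.1 ^ (d - 1 - i)))
      (goodFilter d) (𝓝 (∑ i ∈ range (j + 1), 0 ^ (j - i) * limitConst d i)) := by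
    refine tendsto_finsetSum _ fun i hi => ?_
    have h2 : Tendsto (fun p : Σ n : ℕ, SimpleGraph (Fin n) × ℝ => 1 / √(Real.log p.1))
        (goodFilter d) (𝓝 0) :=
      tendsto_const_nhds.div_atTop (Real.tendsto_sqrt_atTop.comp (tendsto_log_goodFilter d))
    exact (h2.pow _).mul (tendsto_degCount_ratio hd (by simp at hi; omega))
  have e : ∑ i ∈ range (j + 1), 0 ^ (j - i) * limitConst d i = limitConst d j := by
    rw [sum_eq_single j]
    · simp
    · intro i hi hi'
      rw [zero_pow (by simp at hi; omega), zero_mul]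
    · intro h; exact absurd (mem_range.2 (by omega)) h
  rw [e] at h1
  refine h1.congr' ?_
  filter_upwards [eventually_goodFilter_reach hd] with ⟨n, G, X⟩ ⟨h1, h2, h3, _⟩
  simp only at h1 h2 h3 ⊢
  have hL0 : 0 < Real.log n := by linarith
  rw [weight_eq_sum_degCount (d := j + 1) fun v hv => by unfold geom; rw [if_neg (by omega)]]
  rw [sum_div, sum_mul]
  refine sum_congr rfl fun i hi => ?_
  have hi' : i ≤ j := by simp at hi; omega
  unfold geom
  rw [if_pos hi']
  have e2 : Real.log n ^ (d - 1 - i) = Real.log n ^ (d - 1 - j) * Real.log n ^ (j - i) := by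
    rw [← pow_add]; congr 1; omega
  have e3 : Real.log n ^ (j - i) = √(Real.log n) ^ (j - i) * √(Real.log n) ^ (j - i) := by
    rw [← mul_pow, Real.mul_self_sqrt hL0.le]
  have hs : 0 < √(Real.log n) := Real.sqrt_pos.2 hL0
  rw [e2, e3, div_pow, one_pow]
  field_simp

end BurnIn

end RandomDGraph

end

/-! ### Limits of expectations and the probability of a single vertex. -/

noncomputable section

namespace RandomDGraph

open Finset Filter Topology

section Limits

/-- The factor `L ^ (2 d + 2) / n ^ 2` is Markov's inequality for the threshold in `goodFilter`; the
factor `L ^ (2 d)` is the size allowed to a function on bad states. -/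
theorem tendsto_expAt_deviation {d : ℕ} (hd : 2 ≤ d) :
    Tendsto (fun n : ℕ => Real.log n ^ (2 * d) * (Real.log n ^ (2 * d + 2) / (n : ℝ) ^ 2 *
      expAt d (burnIn d n) (fun (G : SimpleGraph (Fin n)) X => deviation d G X))) atTop (𝓝 0) := by
  have hd' : (2 : ℝ) ≤ d := by exact_mod_cast hd
  set C : ℝ := 6000 * d ^ 8 * (2 * d) ^ (4 * d) with hC
  have hC0 : 0 < C := by positivity
  have h1 : Tendsto (fun n : ℕ => 2 * C / Real.log n) atTop (𝓝 0) :=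
    tendsto_const_nhds.div_atTop tendsto_log_natCast
  refine squeeze_zero' (Eventually.of_forall fun n => ?_) ?_ h1
  · have : 0 ≤ expAt d (burnIn d n) (fun (G : SimpleGraph (Fin n)) X => deviation d G X) :=
      expAt_nonneg fun G X => deviation_nonneg d G X
    have h2 : Real.log n ^ (2 * d) = (Real.log n ^ d) ^ 2 := by rw [pow_mul']
    have h3 : Real.log n ^ (2 * d + 2) = (Real.log n ^ (d + 1)) ^ 2 := by
      rw [← pow_mul]; congr 1; ring
    rw [h2, h3]
    positivity
  · filter_upwards [eventually_burnIn_bounds hd, tendsto_log_natCast.eventually_ge_atTop (1 + C),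
      (tendsto_deficit_burnIn hd).eventually_ge_atTop (2 * (d : ℝ) ^ 2)] with n h2 h3 h4
    have hL1 : 1 ≤ Real.log n := by linarith
    have hn := natCast_pos_of_one_le_log hL1
    set L := Real.log n with hL
    have hL0 : 0 < L := by linarith
    have h5 := expAt_deviation_le (V := Fin n) (B := d * L + 1) (by omega) h4
      (by rw [Fintype.card_fin]) (by nlinarith)
    rw [Fintype.card_fin] at h5
    set ρ := deficit (Fin n) d (burnIn d n)
    have hpow : 0 < L ^ (10 * d + 3) := by positivity
    -- The exponent `10 d + 3` in `burnIn` pays for `B ^ (4 d)` and leaves `6 d + 3`, more than the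
    -- `4 d + 2` needed here.
    have hκ : 6000 * (d : ℝ) ^ 8 * (d * L + 1) ^ (4 * d) / ρ ≤ C / L ^ (6 * d + 3) := by
      have e1 : 6000 * (d : ℝ) ^ 8 * (d * L + 1) ^ (4 * d) ≤ C * L ^ (4 * d) :=
        calc 6000 * (d : ℝ) ^ 8 * (d * L + 1) ^ (4 * d) ≤
            6000 * (d : ℝ) ^ 8 * (2 * d * L) ^ (4 * d) := by gcongr; nlinarith
          _ = _ := by rw [hC, mul_pow (2 * (d : ℝ)) L]; ring
      calc _ ≤ C * L ^ (4 * d) / L ^ (10 * d + 3) := div_le_div₀ (by positivity) e1 hpow h2.1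
        _ = _ := by
          rw [show 10 * d + 3 = 4 * d + (6 * d + 3) by ring, pow_add L (4 * d)]
          field_simp
    set κ := 6000 * (d : ℝ) ^ 8 * (d * L + 1) ^ (4 * d) / ρ
    have hκ0 : 0 ≤ κ := div_nonneg (by positivity) (by nlinarith)
    have hκ1 : κ ≤ 1 := by
      refine hκ.trans ?_
      rw [div_le_one (by positivity)]
      calc C ≤ L := by linarith
        _ ≤ L ^ (6 * d + 3) := le_self_pow₀ hL1 (by omega)
    have hexp : Real.exp κ - 1 ≤ 2 * κ := by
      have := Real.abs_exp_sub_one_le (x := κ) (by rwa [abs_of_nonneg hκ0])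
      rw [abs_of_nonneg hκ0] at this
      exact (le_abs_self _).trans this
    have h6 : (Real.exp κ - 1) * (n : ℝ) ^ 2 ≤ 2 * (C / L ^ (6 * d + 3)) * (n : ℝ) ^ 2 := by
      gcongr; linarith
    calc _ ≤ L ^ (2 * d) * (L ^ (2 * d + 2) / (n : ℝ) ^ 2 *
          (2 * (C / L ^ (6 * d + 3)) * (n : ℝ) ^ 2)) := by gcongr; exact h5.trans h6
      _ = 2 * C * (L ^ (4 * d + 2) / L ^ (6 * d + 3)) := by
        rw [show 4 * d + 2 = 2 * d + (2 * d + 2) by ring, pow_add L (2 * d) (2 * d + 2)]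
        field_simp
      _ ≤ 2 * C * (1 / L) := by
        refine mul_le_mul_of_nonneg_left ?_ (by positivity)
        rw [div_le_div_iff₀ (by positivity) hL0, one_mul, ← pow_succ]
        exact pow_le_pow_right₀ hL1 (by omega)
      _ = _ := by ring

/-- Functions that converge along good states converge in expectation. -/
theorem tendsto_expAt_burnIn {d : ℕ} (hd : 2 ≤ d) {φ : ∀ n, SimpleGraph (Fin n) → ℝ → ℝ} {c : ℝ}
    (h : Tendsto (fun p : Σ n : ℕ, SimpleGraph (Fin n) × ℝ => φ p.1 p.2.1 p.2.2) (goodFilter d)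
      (𝓝 c))
    (hb : ∀ᶠ n : ℕ in atTop, ∀ G X, Reach d (burnIn d n) G X →
      |φ n G X| ≤ Real.log n ^ (2 * d)) :
    Tendsto (fun n => expAt d (burnIn d n) (φ n)) atTop (𝓝 c) := by
  have hdev := (tendsto_expAt_deviation hd).const_mul (1 + |c|)
  rw [mul_zero] at hdev
  rw [Metric.tendsto_nhds]
  intro ε hε
  have h1 := eventually_goodFilter.1 (Metric.tendsto_nhds.1 h (ε / 2) (by positivity))
  filter_upwards [h1, hb, tendsto_log_natCast.eventually_ge_atTop 1,
    hdev.eventually_lt_const (show 0 < ε / 2 by positivity)] with n h2 h3 h4 h5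
  have hn := natCast_pos_of_one_le_log h4
  set L := Real.log n
  set k := (1 + |c|) * L ^ (2 * d) * (L ^ (2 * d + 2) / (n : ℝ) ^ 2) with hk
  have hpow : 1 ≤ L ^ (2 * d) := one_le_pow₀ h4
  -- Markov's inequality in pointwise form: on a bad state `k * deviation` already exceeds the crude
  -- bound `L ^ (2 d) + |c|`.
  have key : ∀ G X, Reach d (burnIn d n) G X → |φ n G X - c| ≤ ε / 2 + k * deviation d G X := by
    intro G X hR
    have hdev0 := deviation_nonneg d G X
    have hk0 : 0 ≤ k := by positivity
    by_cases hZ : deviation d G X * L ^ (2 * d + 2) ≤ (n : ℝ) ^ 2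
    · have := h2 G X hR hZ
      rw [Real.dist_eq] at this
      nlinarith [mul_nonneg hk0 hdev0]
    · have hZ' : 1 ≤ L ^ (2 * d + 2) / (n : ℝ) ^ 2 * deviation d G X := by
        rw [div_mul_eq_mul_div, one_le_div (by positivity)]
        linarith
      have e1 := h3 G X hR
      have e2 : (1 + |c|) * L ^ (2 * d) * 1 ≤ k * deviation d G X := by
        rw [hk, mul_assoc ((1 + |c|) * L ^ (2 * d))]
        gcongr
      have e3 := abs_sub (φ n G X) c
      nlinarith [abs_nonneg c]
  have hup : expAt d (burnIn d n) (φ n) ≤ c + ε / 2 + k *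
      expAt d (burnIn d n) (fun (G : SimpleGraph (Fin n)) X => deviation d G X) := by
    rw [← expAt_const_mul, ← expAt_const (V := Fin n) d (burnIn d n) (c + ε / 2), ← expAt_add]
    refine expAt_mono fun G X hR => ?_
    linarith [(abs_le.1 (key G X hR)).2]
  have hlo : c - ε / 2 + (-k) *
      expAt d (burnIn d n) (fun (G : SimpleGraph (Fin n)) X => deviation d G X) ≤
      expAt d (burnIn d n) (φ n) := by
    rw [← expAt_const_mul, ← expAt_const (V := Fin n) d (burnIn d n) (c - ε / 2), ← expAt_add]
    refine expAt_mono fun G X hR => ?_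
    linarith [(abs_le.1 (key G X hR)).1]
  rw [hk] at hup hlo
  rw [Real.dist_eq, abs_lt]
  constructor <;> linarith

theorem weight_le_mul_free {V : Type*} [Fintype V] {d : ℕ} {θ : ℝ} (hθ : 1 ≤ θ) {j : ℕ} (hj : j < d)
    (G : SimpleGraph V) : weight (geom θ j) G ≤ θ ^ j * free d G := by
  have hg := geom_geometric hj hθ
  have : weight (geom θ j) G = ∑ v ∈ unsat d G, geom θ j (deg G v) := by
    symm
    refine sum_subset (subset_univ _) fun v _ hv => ?_
    exact hg.zero _ (by simpa [mem_unsat] using hv)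
  rw [this, free, mul_comm, ← nsmul_eq_mul]
  refine sum_le_card_nsmul _ _ _ fun v _ => ?_
  unfold geom
  split_ifs
  · exact pow_le_pow_right₀ hθ (by omega)
  · positivity

theorem eventually_weight_ratio_le {d : ℕ} (hd : 2 ≤ d) {j : ℕ} (hj : j < d) :
    ∀ᶠ n : ℕ in atTop, ∀ (G : SimpleGraph (Fin n)) X, Reach d (burnIn d n) G X →
      0 ≤ weight (geom (√(Real.log n)) j) G / deficit (Fin n) d (burnIn d n) *
        Real.log n ^ (d - 1 - j) ∧
      weight (geom (√(Real.log n)) j) G / deficit (Fin n) d (burnIn d n) *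
        Real.log n ^ (d - 1 - j) ≤ Real.log n ^ d := by
  filter_upwards [tendsto_log_natCast.eventually_ge_atTop 1,
      (tendsto_deficit_burnIn hd).eventually_ge_atTop (2 * (d : ℝ) ^ 2)] with n h3 h4 G X hR
  have hρ := pos_of_two_mul_sq_le (by omega) h4
  have hθ : 1 ≤ √(Real.log n) := Real.one_le_sqrt.2 h3
  have hθL : √(Real.log n) ≤ Real.log n := by
    rw [Real.sqrt_le_left (by linarith)]; nlinarith
  have h1 := weight_le_mul_free hθ hj G
  have h2 := hR.free_le (by omega) h4
  have h0 := weight_nonneg (geom_geometric hj hθ).nonneg G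
  set L := Real.log n
  set ρ := deficit (Fin n) d (burnIn d n)
  constructor
  · positivity
  · have h5 : weight (geom (√L) j) G / ρ ≤ L ^ j := by
      rw [div_le_iff₀ (by linarith)]
      have hU := free_nonneg d G
      refine h1.trans ?_
      gcongr
    calc _ ≤ L ^ j * L ^ (d - 1 - j) := by gcongr
      _ = L ^ (d - 1) := by rw [← pow_add]; congr 1; omega
      _ ≤ L ^ d := pow_le_pow_right₀ h3 (by omega)

theorem tendsto_expAt_weight_burnIn {d : ℕ} (hd : 2 ≤ d) {j : ℕ} (hj : j < d) :
    Tendsto (fun n : ℕ => expAt d (burnIn d n)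
      (fun (G : SimpleGraph (Fin n)) _ => weight (geom (√(Real.log n)) j) G) /
        deficit (Fin n) d (burnIn d n) * Real.log n ^ (d - 1 - j)) atTop
      (𝓝 (limitConst d j)) := by
  have h1 := tendsto_expAt_burnIn hd (φ := fun n G _ => weight (geom (√(Real.log n)) j) G /
    deficit (Fin n) d (burnIn d n) * Real.log n ^ (d - 1 - j)) (tendsto_weight_ratio hd hj) ?_
  · refine h1.congr fun n => ?_
    rw [div_mul_eq_mul_div, mul_div_assoc, mul_comm, ← expAt_const_mul]
    congr 1
    funext G X
    ring
  · filter_upwards [eventually_weight_ratio_le hd hj, tendsto_log_natCast.eventually_ge_atTop 1]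
      with n h1 h2 G X hR
    obtain ⟨h3, h4⟩ := h1 G X hR
    rw [abs_of_nonneg h3]
    exact h4.trans (pow_le_pow_right₀ h2 (by omega))

theorem tendsto_expAt_degCount_burnIn {d : ℕ} (hd : 2 ≤ d) {j : ℕ} (hj : j < d) :
    Tendsto (fun n : ℕ => expAt d (burnIn d n)
      (fun (G : SimpleGraph (Fin n)) _ => degCount j G) /
        deficit (Fin n) d (burnIn d n) * Real.log n ^ (d - 1 - j)) atTop
      (𝓝 (limitConst d j)) := by
  have h1 := tendsto_expAt_burnIn hd (φ := fun n G _ => degCount j G /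
    deficit (Fin n) d (burnIn d n) * Real.log n ^ (d - 1 - j)) (tendsto_degCount_ratio hd hj) ?_
  · refine h1.congr fun n => ?_
    rw [div_mul_eq_mul_div, mul_div_assoc, mul_comm, ← expAt_const_mul]
    congr 1
    funext G X
    ring
  · filter_upwards [eventually_weight_ratio_le hd hj, tendsto_log_natCast.eventually_ge_atTop 1,
      (tendsto_deficit_burnIn hd).eventually_ge_atTop (2 * (d : ℝ) ^ 2)]
      with n h1 h2 h4 G X hR
    have hρ := pos_of_two_mul_sq_le (by omega) h4
    have h0 := degCount_nonneg j G
    rw [abs_of_nonneg (by positivity)]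
    refine le_trans ?_ ((h1 G X hR).2.trans (pow_le_pow_right₀ h2 (by omega)))
    gcongr
    rw [degCount_eq_weight]
    exact sum_le_sum fun v _ => isDeg_le_geom (Real.one_le_sqrt.2 h2) j _

theorem tendsto_expAt_weight_mul_burnIn {d : ℕ} (hd : 2 ≤ d) {i j : ℕ} (hi : i < d) (hj : j < d) :
    Tendsto (fun n : ℕ => expAt d (burnIn d n) (fun (G : SimpleGraph (Fin n)) _ =>
      weight (geom (√(Real.log n)) i) G * weight (geom (√(Real.log n)) j) G) /
        deficit (Fin n) d (burnIn d n) ^ 2 *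
          (Real.log n ^ (d - 1 - i) * Real.log n ^ (d - 1 - j))) atTop
      (𝓝 (limitConst d i * limitConst d j)) := by
  have h1 := tendsto_expAt_burnIn hd (φ := fun n G _ =>
    (weight (geom (√(Real.log n)) i) G / deficit (Fin n) d (burnIn d n) * Real.log n ^ (d - 1 - i)) *
    (weight (geom (√(Real.log n)) j) G / deficit (Fin n) d (burnIn d n) * Real.log n ^ (d - 1 - j)))
    ((tendsto_weight_ratio hd hi).mul (tendsto_weight_ratio hd hj)) ?_
  · refine h1.congr fun n => ?_
    rw [div_mul_eq_mul_div, mul_div_assoc, mul_comm, ← expAt_const_mul]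
    congr 1
    funext G X
    ring
  · filter_upwards [eventually_weight_ratio_le hd hi, eventually_weight_ratio_le hd hj]
      with n h1 h2 G X hR
    obtain ⟨h3, h4⟩ := h1 G X hR
    obtain ⟨h5, h6⟩ := h2 G X hR
    rw [abs_of_nonneg (mul_nonneg h3 h5), two_mul, pow_add]
    exact mul_le_mul h4 h6 h5 (h3.trans h4)

variable {d : ℕ} {t : ℕ → ℕ}

/-- A bound for the growth exponent during the second phase. -/
def growthBound (d : ℕ) (t : ℕ → ℕ) (n : ℕ) : ℝ :=
  8 / √(Real.log n) * (Real.log 5 + (10 * d + 3 : ℕ) * Real.log (Real.log n)) + 8 * d ^ 2 / t n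

theorem tendsto_growthBound (d : ℕ) (ht : Tendsto (fun n => (t n : ℝ)) atTop atTop) :
    Tendsto (growthBound d t) atTop (𝓝 0) := by
  have h1 : Tendsto (fun x : ℝ => 1 / √x) atTop (𝓝 0) :=
    tendsto_const_nhds.div_atTop Real.tendsto_sqrt_atTop
  have h2 : Tendsto (fun x : ℝ => Real.log x / √x) atTop (𝓝 0) := by
    simp_rw [Real.sqrt_eq_rpow]
    exact (isLittleO_log_rpow_atTop (by norm_num)).tendsto_div_nhds_zero
  have h3 := ((h1.const_mul (8 * Real.log 5)).add
    (h2.const_mul (8 * ((10 * d + 3 : ℕ) : ℝ)))).comp tendsto_log_natCast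
  have h4 : Tendsto (fun n => 8 * (d : ℝ) ^ 2 / t n) atTop (𝓝 0) := tendsto_const_nhds.div_atTop ht
  have h5 := h3.add h4
  simp only [mul_zero, add_zero] at h5
  refine h5.congr fun n => ?_
  simp only [growthBound, Function.comp]
  ring

/-- The facts on the second phase which hold for large `n`. -/
theorem eventually_second_phase (hd : 2 ≤ d) (ht : Tendsto (fun n => (t n : ℝ)) atTop atTop)
    (htd : ∀ᶠ n : ℕ in atTop, (t n : ℝ) ≤ 2 * Real.log n ^ d) :
    ∀ᶠ n : ℕ in atTop, 1 ≤ √(Real.log n) ∧ 1 ≤ Real.log n ∧ burnIn d n ≤ maxEdges d n - t n ∧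
      2 * (d : ℝ) ^ 2 ≤ deficit (Fin n) d (maxEdges d n - t n) ∧
      2 * (t n : ℝ) ≤ deficit (Fin n) d (maxEdges d n - t n) ∧
      deficit (Fin n) d (maxEdges d n - t n) ≤ 2 * t n + 1 ∧
      Real.log (deficit (Fin n) d (burnIn d n)) ≤
        Real.log 5 + (10 * d + 3 : ℕ) * Real.log (Real.log n) ∧
      ∀ s, burnIn d n ≤ s → s ≤ maxEdges d n - t n →
        growth d (√(Real.log n)) (deficit (Fin n) d s) -
          growth d (√(Real.log n)) (deficit (Fin n) d (burnIn d n)) ≤ growthBound d t n := by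
  filter_upwards [tendsto_log_natCast.eventually_ge_atTop 2, htd, eventually_le_maxEdges hd htd,
    ht.eventually_ge_atTop ((d : ℝ) ^ 2), eventually_burnIn_bounds hd] with n hL h1 h2 h3 h4
  have hd' : (2 : ℝ) ≤ d := by exact_mod_cast hd
  have hL1 : 1 ≤ Real.log n := by linarith
  have hL0 : 0 < Real.log n := by linarith
  have hθ : 1 ≤ √(Real.log n) := Real.one_le_sqrt.2 hL1
  obtain ⟨h5, h6⟩ := deficit_maxEdges_sub_bounds h2
  have h8 : burnIn d n ≤ maxEdges d n - t n := by
    have : t n ≤ ⌈Real.log n ^ (10 * d + 3)⌉₊ := by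
      have : (t n : ℝ) ≤ Real.log n ^ (10 * d + 3) :=
        calc (t n : ℝ) ≤ 2 * Real.log n ^ d := h1
          _ ≤ Real.log n * Real.log n ^ d := by gcongr
          _ = Real.log n ^ (d + 1) := by ring
          _ ≤ _ := pow_le_pow_right₀ hL1 (by omega)
      exact_mod_cast this.trans (Nat.le_ceil _)
    unfold burnIn
    omega
  have h9 : Real.log (deficit (Fin n) d (burnIn d n)) ≤
      Real.log 5 + (10 * d + 3 : ℕ) * Real.log (Real.log n) := by
    rw [← Real.log_pow, ← Real.log_mul (by norm_num) (by positivity)]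
    exact Real.log_le_log (lt_of_lt_of_le (by positivity) h4.1) h4.2
  refine ⟨hθ, hL1, h8, by linarith, h5, h6, h9, fun s hs1 hs2 => ?_⟩
  have g1 : deficit (Fin n) d (maxEdges d n - t n) ≤ deficit (Fin n) d s := deficit_mono hs2
  have g2 : deficit (Fin n) d s ≤ deficit (Fin n) d (burnIn d n) := deficit_mono hs1
  unfold growth growthBound
  set ρ := deficit (Fin n) d s
  set ρ₁ := deficit (Fin n) d (burnIn d n)
  have ht0 : 0 < (t n : ℝ) := by nlinarith
  have hρ : 1 ≤ ρ := by nlinarith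
  have hlog : 0 ≤ 8 / √(Real.log n) * Real.log ρ :=
    mul_nonneg (by positivity) (Real.log_nonneg hρ)
  have k1 : 16 * (d : ℝ) ^ 2 / ρ ≤ 8 * d ^ 2 / t n := by
    rw [div_le_div_iff₀ (by linarith) ht0]
    nlinarith [mul_nonneg (sq_nonneg (d : ℝ)) (by linarith : 0 ≤ ρ - 2 * t n)]
  have k2 : 0 ≤ 16 * (d : ℝ) ^ 2 / ρ₁ := div_nonneg (by positivity) (by linarith)
  have k3 := mul_le_mul_of_nonneg_left h9 (show 0 ≤ 8 / √(Real.log n) by positivity)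
  linarith

/-- The normalised pair weights in the second phase are bounded by those at its start. -/
theorem eventually_pairWeight_le (hd : 2 ≤ d) (ht : Tendsto (fun n => (t n : ℝ)) atTop atTop)
    (htd : ∀ᶠ n : ℕ in atTop, (t n : ℝ) ≤ 2 * Real.log n ^ d) {i j : ℕ} (hi : i < d) (hj : j < d) :
    ∀ᶠ n : ℕ in atTop, ∀ s, burnIn d n ≤ s → s ≤ maxEdges d n - t n →
      expAt d s (fun (G : SimpleGraph (Fin n)) _ =>
        pairWeight (geom (√(Real.log n)) i) (geom (√(Real.log n)) j) G) /
          deficit (Fin n) d s ^ 2 ≤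
      Real.exp (growthBound d t n) * (expAt d (burnIn d n) (fun (G : SimpleGraph (Fin n)) _ =>
        weight (geom (√(Real.log n)) i) G * weight (geom (√(Real.log n)) j) G) /
          deficit (Fin n) d (burnIn d n) ^ 2) := by
  filter_upwards [eventually_second_phase hd ht htd] with n ⟨hθ, hL, hb, h1, _, _, _, hg⟩ s hs1 hs2
  have hi' := geom_geometric hi hθ
  have hj' := geom_geometric hj hθ
  refine (expAt_pairWeight_le hi' hj' hθ (by omega) hs1 (h1.trans (deficit_mono hs2))).trans ?_
  have h2 : expAt d (burnIn d n) (fun (G : SimpleGraph (Fin n)) _ =>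
      pairWeight (geom (√(Real.log n)) i) (geom (√(Real.log n)) j) G) ≤
      expAt d (burnIn d n) (fun (G : SimpleGraph (Fin n)) _ =>
        weight (geom (√(Real.log n)) i) G * weight (geom (√(Real.log n)) j) G) :=
    expAt_mono fun G X _ => pairWeight_le hi'.nonneg hj'.nonneg G
  have h0 : 0 ≤ expAt d (burnIn d n) (fun (G : SimpleGraph (Fin n)) _ =>
      pairWeight (geom (√(Real.log n)) i) (geom (√(Real.log n)) j) G) :=
    expAt_nonneg fun G _ => pairWeight_nonneg hi'.nonneg hj'.nonneg G
  have := hg s hs1 hs2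
  gcongr

/-- The normalised expected numbers of vertices of degree `j` in the second phase are bounded by
the normalised weights at its start. -/
theorem eventually_degCount_le (hd : 2 ≤ d) (ht : Tendsto (fun n => (t n : ℝ)) atTop atTop)
    (htd : ∀ᶠ n : ℕ in atTop, (t n : ℝ) ≤ 2 * Real.log n ^ d) {j : ℕ} (hj : j < d) :
    ∀ᶠ n : ℕ in atTop, ∀ s, burnIn d n ≤ s → s ≤ maxEdges d n - t n →
      expAt d s (fun (G : SimpleGraph (Fin n)) _ => degCount j G) / deficit (Fin n) d s ≤
      Real.exp (growthBound d t n) * (expAt d (burnIn d n) (fun (G : SimpleGraph (Fin n)) _ =>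
        weight (geom (√(Real.log n)) j) G) / deficit (Fin n) d (burnIn d n)) := by
  filter_upwards [eventually_second_phase hd ht htd] with n ⟨hθ, hL, hb, h1, _, _, _, hg⟩ s hs1 hs2
  have hj' := geom_geometric hj hθ
  have hs := h1.trans (deficit_mono hs2)
  have hρ := pos_of_two_mul_sq_le (by omega) hs
  have hρ1 := pos_of_two_mul_sq_le (by omega) (hs.trans (deficit_mono hs1))
  have h2 : expAt d s (fun (G : SimpleGraph (Fin n)) _ => degCount j G) / deficit (Fin n) d s ≤
      expAt d s (fun (G : SimpleGraph (Fin n)) _ => weight (geom (√(Real.log n)) j) G) /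
        deficit (Fin n) d s := by
    gcongr
    refine expAt_mono fun G X _ => ?_
    rw [degCount_eq_weight]
    exact sum_le_sum fun v _ => isDeg_le_geom hθ j _
  refine h2.trans ((expAt_weight_le hj' hθ (by omega) hs1 hs).trans ?_)
  have h0 : 0 ≤ expAt d (burnIn d n) (fun (G : SimpleGraph (Fin n)) _ =>
      weight (geom (√(Real.log n)) j) G) :=
    expAt_nonneg fun G _ => weight_nonneg hj'.nonneg G
  have := hg s hs1 hs2
  gcongr

/-- Above, the geometric weight decides. Below, the pair weights cost a relative `1 / log n` per
unit of `log ρ`, and `log ρ` is only `O(log log n)`; the other loss is of relative order `1 / t`. -/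
theorem tendsto_expAt_degCount (hd : 2 ≤ d) (ht : Tendsto (fun n => (t n : ℝ)) atTop atTop)
    (htd : ∀ᶠ n : ℕ in atTop, (t n : ℝ) ≤ 2 * Real.log n ^ d) {j : ℕ} (hj : j < d) :
    Tendsto (fun n : ℕ => expAt d (maxEdges d n - t n)
      (fun (G : SimpleGraph (Fin n)) _ => degCount j G) /
        deficit (Fin n) d (maxEdges d n - t n) * Real.log n ^ (d - 1 - j)) atTop
      (𝓝 (limitConst d j)) := by
  have hexp : Tendsto (fun n => Real.exp (growthBound d t n)) atTop (𝓝 1) := by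
    simpa [Function.comp_def] using
      (Real.continuous_exp.tendsto 0).comp (tendsto_growthBound d ht)
  have hW := hexp.mul (tendsto_expAt_weight_burnIn hd hj)
  rw [one_mul] at hW
  have hD := tendsto_expAt_degCount_burnIn hd hj
  have hQ := hexp.mul (tendsto_expAt_weight_mul_burnIn hd hj (show d - 2 < d by omega))
  have hlog : Tendsto (fun n : ℕ => (Real.log 5 + (10 * d + 3 : ℕ) * Real.log (Real.log n)) /
      Real.log n) atTop (𝓝 0) := by
    have h1 : Tendsto (fun x : ℝ => Real.log 5 / x) atTop (𝓝 0) :=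
      tendsto_const_nhds.div_atTop tendsto_id
    have h2 : Tendsto (fun x : ℝ => Real.log x / x) atTop (𝓝 0) :=
      Real.isLittleO_log_id_atTop.tendsto_div_nhds_zero
    have h3 := (h1.add (h2.const_mul ((10 * d + 3 : ℕ) : ℝ))).comp tendsto_log_natCast
    simp only [mul_zero, add_zero] at h3
    refine h3.congr fun n => ?_
    simp only [Function.comp]
    ring
  have hinv : Tendsto (fun n => 1 / (t n : ℝ)) atTop (𝓝 0) := tendsto_const_nhds.div_atTop ht
  have hlow := (hD.sub ((hQ.mul hlog).const_mul (2 * (d : ℝ) ^ 2))).sub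
    ((hW.mul hinv).const_mul (3 * (d : ℝ) ^ 3))
  simp only [mul_zero, sub_zero] at hlow
  refine tendsto_of_tendsto_of_tendsto_of_le_of_le' hlow hW ?_ ?_
  · filter_upwards [eventually_second_phase hd ht htd, eventually_degCount_le hd ht htd hj,
      eventually_pairWeight_le hd ht htd hj (show d - 2 < d by omega),
      ht.eventually_ge_atTop 1] with n ⟨hθ, hL, hb, h1, h2, _, hl, _⟩ hY hP ht1
    have hL0 : 0 < Real.log n := by linarith
    have key := expAt_degCount_ge (V := Fin n) (j := j) hd hb h1
      (fun s hs1 hs2 => le_trans ?_ (hP s hs1 hs2.le)) (fun s hs1 hs2 => hY s hs1 hs2.le)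
    · have hρ := pos_of_two_mul_sq_le (by omega) h1
      have hρ1 : deficit (Fin n) d (maxEdges d n - t n) ≤ deficit (Fin n) d (burnIn d n) :=
        deficit_mono hb
      have hWn : 0 ≤ expAt d (burnIn d n) (fun (G : SimpleGraph (Fin n)) _ =>
          weight (geom (√(Real.log n)) j) G) :=
        expAt_nonneg fun G _ => weight_nonneg (geom_geometric hj hθ).nonneg G
      have hQn : 0 ≤ expAt d (burnIn d n) (fun (G : SimpleGraph (Fin n)) _ =>
          weight (geom (√(Real.log n)) j) G * weight (geom (√(Real.log n)) (d - 2)) G) :=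
        expAt_nonneg fun G _ => mul_nonneg (weight_nonneg (geom_geometric hj hθ).nonneg G)
          (weight_nonneg (geom_geometric (show d - 2 < d by omega) hθ).nonneg G)
      set ρ := deficit (Fin n) d (maxEdges d n - t n)
      set ρ₁ := deficit (Fin n) d (burnIn d n)
      set P := Real.exp (growthBound d t n) * (expAt d (burnIn d n)
        (fun (G : SimpleGraph (Fin n)) _ => weight (geom (√(Real.log n)) j) G *
          weight (geom (√(Real.log n)) (d - 2)) G) / ρ₁ ^ 2) with hPdef
      set Y := Real.exp (growthBound d t n) * (expAt d (burnIn d n)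
        (fun (G : SimpleGraph (Fin n)) _ => weight (geom (√(Real.log n)) j) G) / ρ₁) with hYdef
      have hP0 : 0 ≤ P := by positivity
      have hY0 : 0 ≤ Y := mul_nonneg (Real.exp_pos _).le (div_nonneg hWn (by linarith))
      have k1 : 2 * d ^ 2 * P * (Real.log ρ₁ - Real.log ρ) ≤ 2 * d ^ 2 * P *
          (Real.log 5 + (10 * d + 3 : ℕ) * Real.log (Real.log n)) := by
        gcongr
        linarith [Real.log_nonneg (show 1 ≤ ρ by linarith)]
      have k2 : 3 * d ^ 3 * Y * (1 / ρ - 1 / ρ₁) ≤ 3 * d ^ 3 * Y * (1 / t n) := by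
        gcongr
        have e1 : 0 ≤ 1 / ρ₁ := one_div_nonneg.2 (by linarith)
        have e2 : 1 / ρ ≤ 1 / t n := one_div_le_one_div_of_le (by linarith) (by linarith)
        linarith
      have k3 := mul_le_mul_of_nonneg_right ((sub_le_sub (sub_le_sub le_rfl k1) k2).trans key)
        (show 0 ≤ Real.log n ^ (d - 1 - j) by positivity)
      refine le_trans (le_of_eq ?_) k3
      -- The exponent 1 is the single power of `log n` by which degrees up to `d - 2` are rarer than
      -- degree `d - 1`; it beats `log log n`.
      rw [show d - 1 - (d - 2) = 1 by omega, pow_one, sub_mul, sub_mul, hPdef, hYdef]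
      congr 1
      · congr 1
        field_simp
      · ring
    · gcongr
      exact expAt_mono fun G X _ => pairWeight_mono (isDeg_nonneg _) (isLow_nonneg _)
        (isDeg_le_geom hθ j) (isLow_le_geom hθ _) G
  · filter_upwards [eventually_second_phase hd ht htd, eventually_degCount_le hd ht htd hj]
      with n ⟨_, hL, hb, _⟩ hY
    have := mul_le_mul_of_nonneg_right (hY _ hb le_rfl)
      (show 0 ≤ Real.log n ^ (d - 1 - j) by positivity)
    rwa [mul_assoc] at this

/-- A Bonferroni inequality: the pair weight equals `D (D - 1)`, and `D - D (D - 1) = D (2 - D)` is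
at most zero for `D ≥ 2`. -/
theorem indicator_degreeCount_bounds {V : Type*} [Fintype V] (j : ℕ) (G : SimpleGraph V) :
    (if degreeCount j G = 1 then (1 : ℝ) else 0) ≤ degCount j G ∧
      degCount j G - pairWeight (isDeg j) (isDeg j) G ≤
        if degreeCount j G = 1 then (1 : ℝ) else 0 := by
  have h1 := weight_mul_weight (isDeg j) (isDeg j) G
  have h2 : ∑ v, isDeg j (deg G v) * isDeg j (deg G v) = degCount j G := by
    rw [degCount_eq_weight, weight]
    refine sum_congr rfl fun v _ => ?_
    unfold isDeg
    split_ifs <;> norm_num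
  rw [h2, ← degCount_eq_weight, degCount_eq] at h1
  rw [degCount_eq]
  split_ifs with h
  · rw [h] at h1 ⊢
    push_cast at h1 ⊢
    constructor <;> linarith
  · refine ⟨by positivity, ?_⟩
    rcases Nat.eq_zero_or_pos (degreeCount j G) with h0 | h0
    · rw [h0] at h1 ⊢
      push_cast at h1 ⊢
      linarith
    · have : (2 : ℝ) ≤ degreeCount j G := by exact_mod_cast (by omega : 2 ≤ degreeCount j G)
      nlinarith

theorem tendsto_degreeCountLaw_one (hd : 2 ≤ d) (ht : Tendsto (fun n => (t n : ℝ)) atTop atTop)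
    (htd : ∀ᶠ n : ℕ in atTop, (t n : ℝ) ≤ 2 * Real.log n ^ d) {j : ℕ} (hj : j < d)
    (htj : Tendsto (fun n : ℕ => (t n : ℝ) / Real.log n ^ (d - 1 - j)) atTop (𝓝 0)) :
    Tendsto (fun n : ℕ => (degreeCountLaw d n j (t n) 1).toReal /
        deficit (Fin n) d (maxEdges d n - t n) * Real.log n ^ (d - 1 - j)) atTop
      (𝓝 (limitConst d j)) := by
  have hD := tendsto_expAt_degCount hd ht htd hj
  have hexp : Tendsto (fun n => Real.exp (growthBound d t n)) atTop (𝓝 1) := by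
    simpa [Function.comp_def] using
      (Real.continuous_exp.tendsto 0).comp (tendsto_growthBound d ht)
  have hQ := hexp.mul (tendsto_expAt_weight_mul_burnIn hd hj hj)
  have hlow := hD.sub (hQ.mul (htj.const_mul 3))
  simp only [mul_zero, sub_zero] at hlow
  refine tendsto_of_tendsto_of_tendsto_of_le_of_le' hlow hD ?_ ?_
  · filter_upwards [eventually_second_phase hd ht htd, eventually_pairWeight_le hd ht htd hj hj,
      ht.eventually_ge_atTop 1] with n ⟨hθ, hL, hb, h1, h2, h3, _⟩ hP ht1
    have hL0 : 0 < Real.log n := by linarith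
    have hP' := hP _ hb le_rfl
    have hρ := pos_of_two_mul_sq_le (by omega) h1
    rw [degreeCountLaw_one]
    have k1 : expAt d (maxEdges d n - t n) (fun (G : SimpleGraph (Fin n)) _ => degCount j G) +
        (-1) * expAt d (maxEdges d n - t n) (fun (G : SimpleGraph (Fin n)) _ =>
          pairWeight (geom (√(Real.log n)) j) (geom (√(Real.log n)) j) G) ≤
        expAt d (maxEdges d n - t n)
          (fun (G : SimpleGraph (Fin n)) _ => if degreeCount j G = 1 then 1 else 0) := by
      rw [← expAt_const_mul, ← expAt_add]
      refine expAt_mono fun G X _ => ?_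
      have e1 := (indicator_degreeCount_bounds j G).2
      have e2 := pairWeight_mono (isDeg_nonneg _) (isDeg_nonneg _)
        (isDeg_le_geom hθ j) (isDeg_le_geom hθ j) G
      linarith
    have hQn : 0 ≤ expAt d (burnIn d n) (fun (G : SimpleGraph (Fin n)) _ =>
        weight (geom (√(Real.log n)) j) G * weight (geom (√(Real.log n)) j) G) :=
      expAt_nonneg fun G _ => mul_self_nonneg _
    set D := expAt d (maxEdges d n - t n) (fun (G : SimpleGraph (Fin n)) _ => degCount j G)
    set Q := expAt d (maxEdges d n - t n) (fun (G : SimpleGraph (Fin n)) _ =>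
          pairWeight (geom (√(Real.log n)) j) (geom (√(Real.log n)) j) G)
    set ρ := deficit (Fin n) d (maxEdges d n - t n)
    set P := Real.exp (growthBound d t n) * (expAt d (burnIn d n)
      (fun (G : SimpleGraph (Fin n)) _ => weight (geom (√(Real.log n)) j) G *
        weight (geom (√(Real.log n)) j) G) / deficit (Fin n) d (burnIn d n) ^ 2) with hPdef
    set ℓ := Real.log n ^ (d - 1 - j) with hℓ
    have hℓ0 : 0 < ℓ := by positivity
    have hP0 : 0 ≤ P := by positivity
    -- Pairs scale like `ρ ^ 2`, so one factor `ρ ≤ 2 t + 1 ≤ 3 t` remains; `htj` makes it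
    -- negligible.
    have k2 : Q / ρ ≤ P * (3 * t n) := by
      have : Q / ρ = Q / ρ ^ 2 * ρ := by field_simp
      rw [this]
      exact mul_le_mul hP' (by linarith) (by linarith) hP0
    have k3 : D / ρ - P * (3 * t n) ≤ expAt d (maxEdges d n - t n)
        (fun (G : SimpleGraph (Fin n)) _ => if degreeCount j G = 1 then 1 else 0) / ρ := by
      have e : D / ρ - Q / ρ ≤ expAt d (maxEdges d n - t n)
          (fun (G : SimpleGraph (Fin n)) _ => if degreeCount j G = 1 then 1 else 0) / ρ := by
        rw [← sub_div]
        gcongr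
        linarith
      linarith
    refine le_trans (le_of_eq ?_) (mul_le_mul_of_nonneg_right k3 hℓ0.le)
    rw [sub_mul, hPdef]
    congr 1
    field_simp
  · filter_upwards [eventually_second_phase hd ht htd] with n ⟨hθ, hL, hb, h1, _⟩
    have hρ := pos_of_two_mul_sq_le (by omega) h1
    rw [degreeCountLaw_one]
    gcongr
    exact expAt_mono fun G X _ => (indicator_degreeCount_bounds j G).1

end Limits

end RandomDGraph

end

/-! ### Passage from the normalised limit to the asymptotic equivalence. -/

open Filter Topology in
theorem corollary6p5 (d j : ℕ) (hj : j + 2 ≤ d) (γ : ℝ) (hγ₀ : 0 < γ)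
    (hγ₁ : γ < (d : ℝ) - 1 - (j : ℝ)) (t : ℕ → ℕ)
    (ht : Asymptotics.IsEquivalent Filter.atTop
      (fun n : ℕ => (t n : ℝ)) (fun n : ℕ => Real.log (n : ℝ) ^ γ)) :
    Asymptotics.IsEquivalent Filter.atTop
      (fun n : ℕ => (RandomDGraph.degreeCountLaw d n j (t n) 1).toReal)
      (fun n : ℕ => 2 * ((d - 1).descFactorial (d - 1 - j) : ℝ) /
        Real.log (n : ℝ) ^ ((d : ℝ) - 1 - (j : ℝ) - γ)) := by
  have hd : 2 ≤ d := by omega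
  have hlog := RandomDGraph.tendsto_log_natCast
  have hpos : ∀ᶠ n : ℕ in atTop, 1 ≤ Real.log n := hlog.eventually_ge_atTop 1
  have hm : ((d - 1 - j : ℕ) : ℝ) = (d : ℝ) - 1 - j := by
    rw [Nat.cast_sub (by omega), Nat.cast_sub (by omega), Nat.cast_one]
  have hratio : Tendsto (fun n : ℕ => (t n : ℝ) / Real.log n ^ γ) atTop (𝓝 1) := by
    refine (Asymptotics.isEquivalent_iff_tendsto_one ?_).1 ht
    filter_upwards [hpos] with n hn
    exact (Real.rpow_pos_of_pos (by linarith) γ).ne'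
  have htop : Tendsto (fun n => (t n : ℝ)) atTop atTop :=
    ht.symm.tendsto_atTop ((tendsto_rpow_atTop hγ₀).comp hlog)
  have htd : ∀ᶠ n : ℕ in atTop, (t n : ℝ) ≤ 2 * Real.log n ^ d := by
    filter_upwards [hpos, hratio.eventually_lt_const (show (1 : ℝ) < 2 by norm_num)] with n hn h2
    have hp : 0 < Real.log n ^ γ := Real.rpow_pos_of_pos (by linarith) γ
    rw [div_lt_iff₀ hp] at h2
    have h3 : Real.log n ^ γ ≤ Real.log n ^ (d : ℝ) :=
      Real.rpow_le_rpow_of_exponent_le hn (by linarith [Nat.cast_nonneg (α := ℝ) j])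
    rw [Real.rpow_natCast] at h3
    linarith
  -- The upper bound on `γ` enters here: it makes two or more vertices of degree `j` unlikely
  -- compared with one.
  have htj : Tendsto (fun n : ℕ => (t n : ℝ) / Real.log n ^ (d - 1 - j)) atTop (𝓝 0) := by
    have h1 : Tendsto (fun n : ℕ => Real.log n ^ (-((d : ℝ) - 1 - j - γ))) atTop (𝓝 0) :=
      (tendsto_rpow_neg_atTop (by linarith)).comp hlog
    have h2 := hratio.mul h1
    rw [mul_zero] at h2
    refine h2.congr' ?_
    filter_upwards [hpos] with n hn
    have hL0 : 0 < Real.log n := by linarith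
    rw [← Real.rpow_natCast (Real.log n) (d - 1 - j), hm, div_mul_eq_mul_div, mul_div_assoc,
      ← Real.rpow_sub hL0, show -((d : ℝ) - 1 - j - γ) - γ = -((d : ℝ) - 1 - j) by ring,
      Real.rpow_neg hL0.le, div_eq_mul_inv]
  have hmain := RandomDGraph.tendsto_degreeCountLaw_one hd htop htd (show j < d by omega) htj
  have hc := RandomDGraph.limitConst_pos d j
  have hdef : Tendsto (fun n : ℕ => RandomDGraph.deficit (Fin n) d
      (RandomDGraph.maxEdges d n - t n) / (t n : ℝ)) atTop (𝓝 2) := by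
    have h1 : Tendsto (fun n => 2 + 1 / (t n : ℝ)) atTop (𝓝 2) := by
      simpa using (tendsto_const_nhds (x := (1 : ℝ)).div_atTop htop).const_add 2
    refine tendsto_of_tendsto_of_tendsto_of_le_of_le' tendsto_const_nhds h1 ?_ ?_
    · filter_upwards [RandomDGraph.eventually_second_phase hd htop htd,
        htop.eventually_ge_atTop 1] with n ⟨_, _, _, _, h2, _⟩ h1
      rw [le_div_iff₀ (by linarith)]
      exact h2
    · filter_upwards [RandomDGraph.eventually_second_phase hd htop htd,
        htop.eventually_ge_atTop 1] with n ⟨_, _, _, _, _, h3, _⟩ h1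
      rw [div_le_iff₀ (by linarith), add_mul, div_mul_cancel₀ _ (by linarith)]
      exact h3
  have hfac : ((d - 1).descFactorial (d - 1 - j) : ℝ) = RandomDGraph.limitConst d j := by
    have h1 := Nat.factorial_mul_descFactorial (show d - 1 - j ≤ d - 1 by omega)
    rw [show d - 1 - (d - 1 - j) = j by omega] at h1
    unfold RandomDGraph.limitConst
    rw [eq_div_iff (by exact_mod_cast j.factorial_ne_zero), mul_comm]
    exact_mod_cast h1
  refine Asymptotics.isEquivalent_of_tendsto_one ?_
  -- The three ratios chain probability to `ρ`, `ρ` to `t` and `t` to `log n ^ γ`; the limit 2 of `ρ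
  -- / t` gives the factor 2.
  have hfin := ((hmain.mul hdef).mul hratio).div_const (2 * RandomDGraph.limitConst d j)
  rw [mul_one, mul_comm (RandomDGraph.limitConst d j) 2, div_self (by positivity)] at hfin
  refine hfin.congr' ?_
  filter_upwards [RandomDGraph.eventually_second_phase hd htop htd,
    htop.eventually_ge_atTop 1] with n ⟨_, hL, _, _, h2, _⟩ h1
  have hL0 : 0 < Real.log n := by linarith
  have hρ : RandomDGraph.deficit (Fin n) d (RandomDGraph.maxEdges d n - t n) ≠ 0 := by linarith
  have ht0 : (t n : ℝ) ≠ 0 := by linarith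
  have hp : 0 < Real.log n ^ γ := Real.rpow_pos_of_pos hL0 γ
  rw [Pi.div_apply, hfac, Real.rpow_sub hL0, ← hm, Real.rpow_natCast]
  field_simp
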